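/- **Linear plethysm in noncommuting variables.** Let $W$ be the set of nonempty finite words $\omega=\omega_1\cdots\omega_n$ of positive integers. For a formal power series without constant term $F=\sum_{\omega\in W}f_\omega x_\omega$ over $\mathbb Q$ in noncommuting variables $x_1,x_2,\dots$ (with $x_\omega=x_{\omega_1}\cdots x_{\omega_n}$) put $F_k=F(x_k,x_{2k},x_{3k},\dots)$, and for two such series let $G\circledast F=G(F_1,F_2,\dots)$ be plethystic substitution. Let $\mathcal P^{\diamond}_{\mathrm{lin}}$ be the (commutative) polynomial $\mathbb Q$-algebra on the symbols $a_\omega$, $\omega\in W$, where $a_\omega$ stands for the function $F\mapsto f_\omega$ (no symmetry factor $\omega!$), with comultiplication $\Delta(a_\omega)(F,G)=a_\omega(G\circledast F)$ and counit $\varepsilon(a_\omega)=a_\omega(x_1)$. Let $\mathsf M^r$ be the free semigroup monad on sets, $A\mapsto\bigsqcup_{n\ge1}A^n$, and let $\mathsf S$ and $\mathsf S^r$ be the free symmetric monoidal and free symmetric semimonoidal groupoid monads, $X\mapsto\bigsqcup_{n\ge0}X^n/\!\!/\mathfrak S_n$ and $X\mapsto\bigsqcup_{n\ge1}X^n/\!\!/\mathfrak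 S_n$. Let $\mathsf{Ass}$ be the terminal $\mathsf M^r$-operad (the nonsymmetric operad with one operation of each arity $n\ge1$). For an $\mathsf M^r$-operad $Q$ with set of colours $Q_0$, let $\mathcal T^{\mathsf M^r}Q$ be the following $\mathsf M^r$-operad. First, $Q$ gives a category with objects $Q_0$ whose arrows $c\to c'$ are the operations of $Q$ with output $c'$ all of whose inputs are $c$, the composite of $x:c\to c'$ and $y:c'\to c''$ being $y\circ(x,\dots,x)$. Then a category gives an $\mathsf M^r$-operad whose operations with inputs $c_1,\dots,c_n$ and output $c$ are the sequences of arrows $(x_i:c_i\to c)_{1\le i\le n}$, $n\ge1$, with $x\circ(y^1,\dots,y^k)=(x_i\circ y^i_j)_{i,j}$. (So the operations of $\mathcal T^{\mathsf M^r}\mathsf{Ass}$ are the words $\omega\in W$.) For an $\mathsf M^r$-operad $R$ and $\mathsf P\in\{\mathsf S,\mathsf S^r\}$, the two-sided bar construction $X=\mathcal B^{\mathsf P}R$ has as groupoid of $n$-simplices $X_n=\mathsf P$(the set of $n$-level trees of operations of $R$); the top face maps delete the root operations, the other face maps are given by the operad structure, the degeneracies by the units, and there is a product $X_n\times X_n\to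 X_n$ given by juxtaposition. When $X$ is locally finite (automorphism groups in $X_1$ are finite, and the homotopy fibres of $s_0:X_0\to X_1$ and $d_1:X_2\to X_1$ are finite groupoids), the homotopy cardinality of its incidence bialgebra is the $\mathbb Q$-vector space with basis $\delta_f=|\ulcorner f\urcorner|$ indexed by the isomorphism classes of objects $f$ of $X_1$, with $\delta_f\delta_g=\delta_{f\otimes g}$, $\Delta(\delta_f)=|(d_2,d_0)_!\,d_1^*\ulcorner f\urcorner|$ and $\varepsilon(\delta_f)=|s_0^*\ulcorner f\urcorner|$, where pullbacks are homotopy pullbacks and $|\cdot|$ is homotopy cardinality. (It has a unit, the empty sequence, for $\mathsf P=\mathsf S$ and no unit for $\mathsf P=\mathsf S^r$.) **Theorem.** $\mathcal B^{\mathsf S}\mathcal T^{\mathsf M^r}(\mathsf{Ass})$ and $\mathcal B^{\mathsf S^r}\mathcal T^{\mathsf M^r}(\mathsf{Ass})$ are locally finite. There is exactly one algebra homomorphism $\Delta:\mathcal P^{\diamond}_{\mathrm{lin}}\to\mathcal P^{\diamond}_{\mathrm{lin}}\otimes\mathcal P^{\diamond}_{\mathrm{lin}}$ with $\Delta(a_\omega)(F,G)=a_\omega(G\circledast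 F)$ for all $\omega,F,G$, and $(\mathcal P^{\diamond}_{\mathrm{lin}},\Delta,\varepsilon)$ is a bialgebra. It is isomorphic to the homotopy cardinality of the incidence bialgebra of $\mathcal B^{\mathsf S^r}\mathcal T^{\mathsf M^r}(\mathsf{Ass})$, in the following precise sense: 1. there is an injective homomorphism of nonunital algebras from the homotopy cardinality of the incidence bialgebra of $\mathcal B^{\mathsf S^r}\mathcal T^{\mathsf M^r}(\mathsf{Ass})$ to $\mathcal P^{\diamond}_{\mathrm{lin}}$, compatible with comultiplications and counits, whose image consists exactly of the polynomials with zero constant term (so that $\mathcal P^{\diamond}_{\mathrm{lin}}$ is obtained from it by adjoining a unit); 2. the homotopy cardinality of the incidence bialgebra of $\mathcal B^{\mathsf S}\mathcal T^{\mathsf M^r}(\mathsf{Ass})$, in which the empty sequence is the unit, is a bialgebra and is isomorphic to $\mathcal P^{\diamond}_{\mathrm{lin}}$ as a bialgebra. -/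

import Mathlib

open CategoryTheory
open scoped TensorProduct

namespace Pleth

/-! ## The free semigroup monad on sets -/

/-- The free semigroup on a set `A`: nonempty finite sequences of elements of `A`. -/
@[ext]
structure Mr (A : Type) where
  toList : List A
  ne_nil : toList ≠ []

namespace Mr

variable {A B E : Type}

/-- The action of the free semigroup monad on maps. -/
def map (f : A → B) (x : Mr A) : Mr B := ⟨x.toList.map f, by simpa using x.ne_nil⟩

/-- The unit: sequences of length one. -/
def unit (a : A) : Mr A := ⟨[a], by simp⟩

/-- The multiplication: concatenation of a sequence of sequences. -/
def mul (x : Mr (Mr A)) : Mr A :=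
  ⟨x.toList.flatMap toList, by
    obtain ⟨l, hl⟩ := x
    cases l with
    | nil => exact absurd rfl hl
    | cons a l =>
      intro h
      rw [List.flatMap_cons, List.append_eq_nil_iff] at h
      exact a.ne_nil h.1⟩

/-- The strength `A × Mr B → Mr (A × B)`. -/
def strength (p : A × Mr B) : Mr (A × B) := p.2.map (fun b => (p.1, b))

/-- The component `D_A : A × Mr 1 → Mr A` of the strength (with `A × 1` identified with `A`),
sending `(a, (∗, …, ∗))` to `(a, …, a)`. -/
def D (p : A × Mr Unit) : Mr A := (strength p).map Prod.fst

theorem map_map (g : B → E) (f : A → B) (x : Mr A) : (x.map f).map g = x.map (g ∘ f) :=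
  Mr.ext (List.map_map ..)

theorem map_id' (x : Mr A) : x.map (fun a => a) = x := Mr.ext (List.map_id' _)

theorem map_unit (f : A → B) (a : A) : (unit a).map f = unit (f a) := rfl

theorem map_mul (f : A → B) (x : Mr (Mr A)) : (mul x).map f = mul (x.map (map f)) := by
  apply Mr.ext
  simp only [mul, map, List.map_flatMap, List.flatMap_map]

theorem mul_unit (x : Mr A) : mul (unit x) = x := Mr.ext (by simp [mul, unit])

theorem mul_map_unit (x : Mr A) : mul (x.map unit) = x := Mr.ext (by
  simp [mul, map, unit, List.flatMap_map])

theorem mul_mul (x : Mr (Mr (Mr A))) : mul (mul x) = mul (x.map mul) := Mr.ext (by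
  simp only [mul, map, List.flatMap_map, List.flatMap_assoc])

theorem D_eq (a : A) (u : Mr Unit) : D (a, u) = u.map (fun _ => a) := map_map ..

theorem map_D (f : A → B) (a : A) (u : Mr Unit) : (D (a, u)).map f = D (f a, u) := by
  simp only [D_eq, map_map]; rfl

theorem map_terminal_D (a : A) (u : Mr Unit) : (D (a, u)).map (fun _ => ()) = u := by
  rw [map_D, D_eq]; exact map_id' u

theorem D_unit (a : A) : D (a, unit ()) = unit a := rfl

/-- Pairing of two sequences that agree over a common base, position by position: this is the
inverse of the canonical map `Mr (A ×_C B) → Mr A ×_{Mr C} Mr B`. -/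
def pairList {C : Type} (f : A → C) (g : B → C) : (l : List A) → (l' : List B) → l.map f = l'.map g →
    List {p : A × B // f p.1 = g p.2}
  | [], _, _ => []
  | _ :: _, [], _ => []
  | a :: l, b :: l', h =>
    ⟨(a, b), (List.cons.inj h).1⟩ :: pairList f g l l' (List.cons.inj h).2

theorem pairList_eq {C : Type} (f : A → C) (g : B → C) (k : A → B → E) :
    ∀ (l : List A) (l' : List B) (h : l.map f = l'.map g),
      (pairList f g l l' h).map (fun p => k p.1.1 p.1.2) = List.zipWith k l l'
  | [], _, _ => by simp [pairList]
  | _ :: _, [], h => by simp at h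
  | a :: l, b :: l', h => by
    simp only [pairList, List.map_cons, List.zipWith_cons_cons]
    rw [pairList_eq f g k l l']

/-- `Mr` preserves pullbacks: the canonical map `Mr (A ×_C B) → Mr A ×_{Mr C} Mr B` has this
inverse. -/
def pair {C : Type} (f : A → C) (g : B → C) (x : Mr A) (y : Mr B) (h : x.map f = y.map g) :
    Mr {p : A × B // f p.1 = g p.2} :=
  ⟨pairList f g x.toList y.toList (congrArg toList h), by
    obtain ⟨l, hl⟩ := x
    obtain ⟨l', hl'⟩ := y
    cases l with
    | nil => exact absurd rfl hl
    | cons a l => cases l' with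
      | nil => exact absurd rfl hl'
      | cons b l' => simp [pairList]⟩

theorem pair_fst {C : Type} (f : A → C) (g : B → C) (x : Mr A) (y : Mr B) (h : x.map f = y.map g) :
    (pair f g x y h).map (fun p => p.1.1) = x := Mr.ext (by
  have hl : x.toList.length = y.toList.length := by
    simpa [map] using congrArg List.length (congrArg toList h)
  have := pairList_eq f g (fun a _ => a) x.toList y.toList (congrArg toList h)
  change (pairList f g x.toList y.toList _).map _ = _
  rw [this]
  apply List.ext_getElem <;> simp [hl])

theorem pair_snd {C : Type} (f : A → C) (g : B → C) (x : Mr A) (y : Mr B) (h : x.map f = y.map g) :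
    (pair f g x y h).map (fun p => p.1.2) = y := Mr.ext (by
  have hl : x.toList.length = y.toList.length := by
    simpa [map] using congrArg List.length (congrArg toList h)
  have := pairList_eq f g (fun _ b => b) x.toList y.toList (congrArg toList h)
  change (pairList f g x.toList y.toList _).map _ = _
  rw [this]
  apply List.ext_getElem <;> simp [hl])

/-- An element of `Mr (A ×_C B)` is determined by its two projections. -/
theorem pair_ext {P : A × B → Prop} {z w : Mr {p : A × B // P p}}
    (h₁ : z.map (fun p => p.1.1) = w.map (fun p => p.1.1))
    (h₂ : z.map (fun p => p.1.2) = w.map (fun p => p.1.2)) : z = w := by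
  apply Mr.ext
  have h₁' : z.toList.map (fun p => p.1.1) = w.toList.map (fun p => p.1.1) := congrArg toList h₁
  have h₂' : z.toList.map (fun p => p.1.2) = w.toList.map (fun p => p.1.2) := congrArg toList h₂
  have hl : z.toList.length = w.toList.length := by simpa using congrArg List.length h₁'
  apply List.ext_getElem hl
  intro i hi hi'
  apply Subtype.ext
  apply Prod.ext
  · have := congrArg (fun l => l[i]?) h₁'
    simpa [hi, hi'] using this
  · have := congrArg (fun l => l[i]?) h₂'
    simpa [hi, hi'] using this

end Mr

/-! ## Categories and `Mr`-operads as monads in spans -/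

/-- A category internal to sets, presented by a span `C₀ ← C₁ → C₀` with composition
`C₁ ×_{C₀} C₁ → C₁` and identities `C₀ → C₁`. -/
structure IntCat where
  C₀ : Type
  C₁ : Type
  src : C₁ → C₀
  tgt : C₁ → C₀
  /-- `comp f g` is `f` followed by `g`. -/
  comp : (f g : C₁) → tgt f = src g → C₁
  one : C₀ → C₁
  src_comp : ∀ f g h, src (comp f g h) = src f
  tgt_comp : ∀ f g h, tgt (comp f g h) = tgt g
  src_one : ∀ c, src (one c) = c
  tgt_one : ∀ c, tgt (one c) = c
  one_comp : ∀ f, comp (one (src f)) f (tgt_one _) = f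
  comp_one : ∀ f, comp f (one (tgt f)) (src_one _).symm = f
  assoc : ∀ f g k (h : tgt f = src g) (h' : tgt g = src k),
    comp (comp f g h) k ((tgt_comp ..).trans h') = comp f (comp g k h') (h.trans (src_comp ..).symm)

/-- An `Mr`-operad (nonsymmetric coloured operad without nullary operations), presented by a span
`Mr Q₀ ← Q₁ → Q₀` with composition `Mr Q₁ ×_{Mr Q₀} Q₁ → Q₁` and units `Q₀ → Q₁`. -/
structure MrOperad where
  Q₀ : Type
  Q₁ : Type
  s : Q₁ → Mr Q₀
  t : Q₁ → Q₀
  /-- `m y x` plugs the sequence of operations `y` into the inputs of `x`. -/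
  m : (y : Mr Q₁) → (x : Q₁) → y.map t = s x → Q₁
  e : Q₀ → Q₁
  s_m : ∀ y x h, s (m y x h) = Mr.mul (y.map s)
  t_m : ∀ y x h, t (m y x h) = t x
  s_e : ∀ c, s (e c) = Mr.unit c
  t_e : ∀ c, t (e c) = c
  m_e : ∀ x, m (Mr.unit x) (e (t x)) (s_e (t x)).symm = x
  e_m : ∀ x (h : ((s x).map e).map t = s x), m ((s x).map e) x h = x
  assoc : ∀ (w : Mr {p : Mr Q₁ × Q₁ // p.1.map t = s p.2}) (x : Q₁)
    (h₁ : (w.map (fun p => m p.1.1 p.1.2 p.2)).map t = s x)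
    (h₂ : (w.map (fun p => p.1.2)).map t = s x)
    (h₃ : (Mr.mul (w.map (fun p => p.1.1))).map t = s (m (w.map (fun p => p.1.2)) x h₂)),
    m (w.map (fun p => m p.1.1 p.1.2 p.2)) x h₁ =
      m (Mr.mul (w.map (fun p => p.1.1))) (m (w.map (fun p => p.1.2)) x h₂) h₃

theorem MrOperad.m_congr (Q : MrOperad) {y y' : Mr Q.Q₁} {x x' : Q.Q₁} {h : y.map Q.t = Q.s x}
    {h' : y'.map Q.t = Q.s x'} (hy : y = y') (hx : x = x') : Q.m y x h = Q.m y' x' h' := by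
  subst hy hx; rfl

/-- The reduced associative operad: the terminal `Mr`-operad, given by the span
`Mr 1 ← Mr 1 → 1` with composition and unit those of the monad. -/
def Ass : MrOperad where
  Q₀ := Unit
  Q₁ := Mr Unit
  s := fun x => x
  t := fun _ => ()
  m := fun y _ _ => Mr.mul y
  e := Mr.unit
  s_m := fun y _ _ => by rw [Mr.map_id']
  t_m := fun _ _ _ => rfl
  s_e := fun _ => rfl
  t_e := fun _ => rfl
  m_e := fun x => Mr.mul_unit x
  e_m := fun x _ => Mr.mul_map_unit x
  assoc := fun w x _ _ _ => by
    rw [Mr.mul_mul, Mr.map_map]; rfl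

/-! ## The two halves of the T-construction -/

/-- The pullback of `D : Q₀ × Mr 1 → Mr Q₀` and `s : Q₁ → Mr Q₀`, i.e. the operations all of whose
inputs have the same colour. -/
@[ext]
structure MrOperad.Arr (Q : MrOperad) where
  base : Q.Q₀ × Mr Unit
  op : Q.Q₁
  eq : Mr.D base = Q.s op

/-- The T-construction from `Mr`-operads to categories: objects are the colours, and the arrows are
the operations all of whose inputs have the same colour. The composite of `x : c → c'` and
`y : c' → c''` is the operation `y ∘ (x, …, x)`. -/
def MrOperad.toCat (Q : MrOperad) : IntCat where
  C₀ := Q.Q₀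
  C₁ := Q.Arr
  src := fun f => f.base.1
  tgt := fun f => Q.t f.op
  comp := fun f g h =>
    { base := (f.base.1, Mr.mul (Mr.D (f.base.2, g.base.2)))
      op := Q.m (Mr.D (f.op, g.base.2)) g.op (by rw [Mr.map_D, h]; exact g.eq)
      eq := by rw [Q.s_m, Mr.map_D, ← f.eq, Mr.D_eq, Mr.map_mul, Mr.map_D, ← Mr.D_eq] }
  one := fun c => ⟨(c, Mr.unit ()), Q.e c, by rw [Q.s_e]; rfl⟩
  src_comp := fun _ _ _ => rfl
  tgt_comp := fun _ _ _ => Q.t_m ..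
  src_one := fun _ => rfl
  tgt_one := fun c => Q.t_e c
  one_comp := fun f => by
    obtain ⟨⟨c, u⟩, q, hf⟩ := f
    refine Arr.ext (Prod.ext rfl ?_) ?_
    · change Mr.mul (Mr.D (Mr.unit (), u)) = u
      rw [Mr.D_eq]; exact Mr.mul_map_unit u
    · refine (Q.m_congr ?_ rfl).trans (Q.e_m q ?_)
      · change Mr.D (Q.e c, u) = _
        rw [← hf, Mr.map_D]
      · rw [← hf, Mr.map_D, Mr.map_D, Q.t_e]
  comp_one := fun f => by
    obtain ⟨⟨c, u⟩, q, hf⟩ := f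
    exact Arr.ext (Prod.ext rfl (Mr.mul_unit u)) (Q.m_e q)
  assoc := fun f g k h h' => by
    obtain ⟨⟨c, u⟩, q, hf⟩ := f
    obtain ⟨⟨c', u'⟩, q', hg⟩ := g
    obtain ⟨⟨c'', u''⟩, q'', hk⟩ := k
    change Q.t q = c' at h
    change Q.t q' = c'' at h'
    subst h h'
    have e₁ : (Mr.D (q, u')).map Q.t = Q.s q' := by rw [Mr.map_D]; exact hg
    have e₂ : (Mr.D (q', u'')).map Q.t = Q.s q'' := by rw [Mr.map_D]; exact hk
    refine Arr.ext (Prod.ext rfl ?_) ?_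
    · change Mr.mul (Mr.D (Mr.mul (Mr.D (u, u')), u'')) = Mr.mul (Mr.D (u, Mr.mul (Mr.D (u', u''))))
      simp only [Mr.D_eq, Mr.map_mul, Mr.mul_mul, Mr.map_map]
      rfl
    · have key := Q.assoc (Mr.D (⟨(Mr.D (q, u'), q'), e₁⟩, u'')) q''
        (by rw [Mr.map_D, Mr.map_D, Q.t_m]; exact hk) (by rw [Mr.map_D]; exact e₂)
        (by
          rw [Mr.map_D, Q.s_m, Mr.map_D, Mr.map_mul, Mr.map_D, Mr.map_D]
          refine congrArg Mr.mul (Eq.trans ?_ (Mr.map_D Q.s q' u'').symm)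
          rw [← hg])
      refine (Q.m_congr ?_ rfl).trans (key.trans (Q.m_congr ?_ (Q.m_congr ?_ rfl)))
      · exact (Mr.map_D (fun p : {p : Mr Q.Q₁ × Q.Q₁ // p.1.map Q.t = Q.s p.2} =>
          Q.m p.1.1 p.1.2 p.2) ⟨(Mr.D (q, u'), q'), e₁⟩ u'').symm
      · rw [Mr.map_D]
        change _ = Mr.D (q, Mr.mul (Mr.D (u', u'')))
        simp only [Mr.D_eq, Mr.map_mul, Mr.map_map]
        rfl
      · rw [Mr.map_D]

namespace IntCat

variable (C : IntCat)

/-- The operations of the operad associated with a category: the pullback of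
`Mr C₁ → Mr C₀` (targets) and `D : C₀ × Mr 1 → Mr C₀`, i.e. the nonempty sequences of arrows
with a common target. -/
structure Op where
  arr : Mr C.C₁
  base : C.C₀ × Mr Unit
  eq : arr.map C.tgt = Mr.D base

/-- For an operation `(f₁, …, fₙ)` with target `c` and an arrow `g` with source `c`, the sequence
`(g ∘ f₁, …, g ∘ fₙ)`: pair `(f₁, …, fₙ)` with `D (g, (∗, …, ∗)) = (g, …, g)` to a sequence of
composable pairs, and apply composition. -/
def whisker (q : {q : C.Op × C.C₁ // q.1.base.1 = C.src q.2}) : Mr C.C₁ :=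
  (Mr.pair C.tgt C.src q.1.1.arr (Mr.D (q.1.2, q.1.1.base.2)) (by
    rw [Mr.map_D, ← q.2]; exact q.1.1.eq)).map (fun p => C.comp p.1.1 p.1.2 p.2)

theorem whisker_tgt (q : {q : C.Op × C.C₁ // q.1.base.1 = C.src q.2}) :
    (C.whisker q).map C.tgt = Mr.D (C.tgt q.1.2, q.1.1.base.2) := by
  have h := Mr.pair_snd C.tgt C.src q.1.1.arr
    (Mr.D (q.1.2, q.1.1.base.2)) (by rw [Mr.map_D, ← q.2]; exact q.1.1.eq)
  rw [whisker, Mr.map_map]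
  refine Eq.trans (congrArg (fun k => Mr.map k _) (funext fun p => C.tgt_comp ..))
    ((Mr.map_map C.tgt _ _).symm.trans ((congrArg (Mr.map C.tgt) h).trans (Mr.map_D ..)))

theorem whisker_src (q : {q : C.Op × C.C₁ // q.1.base.1 = C.src q.2}) :
    (C.whisker q).map C.src = q.1.1.arr.map C.src := by
  conv_rhs => rw [← Mr.pair_fst C.tgt C.src q.1.1.arr
    (Mr.D (q.1.2, q.1.1.base.2)) (by rw [Mr.map_D, ← q.2]; exact q.1.1.eq), Mr.map_map]
  rw [whisker, Mr.map_map]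
  exact congrArg (fun k => Mr.map k _) (funext fun p => C.src_comp ..)

theorem Op.tgt_mem {C : IntCat} (x : C.Op) {f : C.C₁} (hf : f ∈ x.arr.toList) :
    C.tgt f = x.base.1 := by
  have h := congrArg Mr.toList x.eq
  rw [Mr.D_eq] at h
  have h' : C.tgt f ∈ x.arr.toList.map C.tgt := List.mem_map_of_mem hf
  rw [show x.arr.toList.map C.tgt = x.base.2.toList.map (fun _ => x.base.1) from h] at h'
  obtain ⟨_, _, h⟩ := List.mem_map.1 h'
  exact h.symm

theorem Op.ext' {C : IntCat} {x y : C.Op} (h : x.arr.toList = y.arr.toList)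
    (h' : x.base.1 = y.base.1) : x = y := by
  obtain ⟨p, ⟨c, u⟩, hx⟩ := x
  obtain ⟨p', ⟨c', u'⟩, hy⟩ := y
  have hp : p = p' := Mr.ext h
  change c = c' at h'
  subst hp h'
  have : u = u' := by
    rw [← Mr.map_terminal_D c u, ← Mr.map_terminal_D c u', ← hx, hy]
  subst this
  rfl

/-- Composition of operations:
`x ∘ (y¹, …, yᵏ) = (x₁ ∘ y¹₁, …, x₁ ∘ y¹ₙ₁, …, xₖ ∘ yᵏ₁, …, xₖ ∘ yᵏₙₖ)`. -/
def opComp (y : Mr C.Op) (x : C.Op) (h : y.map (fun f => f.base.1) = x.arr.map C.src) : C.Op where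
  arr := Mr.mul ((Mr.pair (fun f : C.Op => f.base.1) C.src y x.arr h).map C.whisker)
  base := (x.base.1, Mr.mul (y.map (fun f => f.base.2)))
  eq := by
    have hy := Mr.pair_fst (fun f : C.Op => f.base.1) C.src y x.arr h
    have hx := Mr.pair_snd (fun f : C.Op => f.base.1) C.src y x.arr h
    set z := Mr.pair (fun f : C.Op => f.base.1) C.src y x.arr h
    rw [Mr.map_mul, Mr.map_map, ← hy, Mr.D_eq, Mr.map_mul, Mr.map_map, Mr.map_map]
    refine congrArg Mr.mul (Mr.ext (List.map_congr_left fun q hq => ?_))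
    have hq' : q.1.2 ∈ x.arr.toList := by rw [← hx]; exact List.mem_map_of_mem hq
    rw [Function.comp_apply, whisker_tgt, x.tgt_mem hq', Mr.D_eq]
    rfl

open Classical in
/-- Composition extended to all pairs of arrows (auxiliary, for the proofs of the axioms). -/
noncomputable def comp' (f g : C.C₁) : C.C₁ := if h : C.tgt f = C.src g then C.comp f g h else f

theorem comp'_eq {f g : C.C₁} (h : C.tgt f = C.src g) : C.comp' f g = C.comp f g h := dif_pos h

theorem comp'_one {f : C.C₁} {c : C.C₀} (h : C.tgt f = c) : C.comp' f (C.one c) = f := by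
  subst h
  rw [comp'_eq C (C.src_one _).symm, C.comp_one]

theorem one_comp' (f : C.C₁) : C.comp' (C.one (C.src f)) f = f := by
  rw [comp'_eq C (C.tgt_one _), C.one_comp]

theorem comp'_assoc {f g k : C.C₁} (h : C.tgt f = C.src g) (h' : C.tgt g = C.src k) :
    C.comp' (C.comp' f g) k = C.comp' f (C.comp' g k) := by
  rw [comp'_eq C h, comp'_eq C h', comp'_eq C ((C.tgt_comp ..).trans h'),
    comp'_eq C (h.trans (C.src_comp ..).symm), C.assoc]

/-- The list underlying `whisker` (auxiliary). -/
noncomputable def K (y : C.Op) (g : C.C₁) : List C.C₁ := y.arr.toList.map (fun f => C.comp' f g)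

theorem whisker_toList (q : {q : C.Op × C.C₁ // q.1.base.1 = C.src q.2}) :
    (C.whisker q).toList = C.K q.1.1 q.1.2 := by
  have e : (Mr.D (q.1.2, q.1.1.base.2)).toList.length = q.1.1.arr.toList.length := by
    have := congrArg (fun l => l.toList.length) q.1.1.eq
    rw [Mr.D_eq] at this ⊢
    simpa [Mr.map] using this.symm
  have := Mr.pairList_eq C.tgt C.src C.comp' q.1.1.arr.toList
    (Mr.D (q.1.2, q.1.1.base.2)).toList (congrArg Mr.toList
      (show q.1.1.arr.map C.tgt = (Mr.D (q.1.2, q.1.1.base.2)).map C.src by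
        rw [Mr.map_D, ← q.2]; exact q.1.1.eq))
  change (Mr.pairList C.tgt C.src _ _ _).map _ = _
  have e' : (fun p : {p : C.C₁ × C.C₁ // C.tgt p.1 = C.src p.2} => C.comp p.1.1 p.1.2 p.2) =
      fun p => C.comp' p.1.1 p.1.2 := funext fun p => (C.comp'_eq p.2).symm
  rw [e', this, K]
  apply List.ext_getElem
  · simp [e]
  · intro i _ _
    simp [Mr.D_eq, Mr.map]

theorem opComp_toList (y : Mr C.Op) (x : C.Op)
    (h : y.map (fun f => f.base.1) = x.arr.map C.src) :
    (C.opComp y x h).arr.toList = (List.zipWith C.K y.toList x.arr.toList).flatten := by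
  rw [← Mr.pairList_eq (fun f : C.Op => f.base.1) C.src C.K y.toList x.arr.toList
    (congrArg Mr.toList h)]
  change List.flatMap Mr.toList (List.map C.whisker (Mr.pairList (fun f : C.Op => f.base.1) C.src _ _ _)) = _
  rw [List.flatMap_map, List.flatMap_def]
  exact congrArg (fun k => (List.map k _).flatten) (funext C.whisker_toList)

theorem K_comp (y : Mr C.Op) (x : C.Op) (h : y.map (fun f => f.base.1) = x.arr.map C.src)
    (g : C.C₁) (hg : x.base.1 = C.src g) :
    C.K (C.opComp y x h) g = (List.zipWith C.K y.toList (C.K x g)).flatten := by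
  have key : ∀ (l : List C.Op) (l' : List C.C₁), l.map (fun f => f.base.1) = l'.map C.src →
      (∀ f ∈ l', C.tgt f = C.src g) →
      (List.zipWith C.K l l').flatten.map (fun f => C.comp' f g) =
        (List.zipWith C.K l (l'.map (fun f => C.comp' f g))).flatten := by
    intro l
    induction l with
    | nil => intro l' _ _; simp
    | cons a l ih =>
      intro l' hl hm
      cases l' with
      | nil => simp at hl
      | cons b l' =>
        rw [List.map_cons, List.map_cons, List.cons.injEq] at hl
        rw [List.zipWith_cons_cons, List.flatten_cons, List.map_append, List.map_cons,
          List.zipWith_cons_cons, List.flatten_cons,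
          ih l' hl.2 (fun f hf => hm f (List.mem_cons_of_mem _ hf))]
        congr 1
        rw [K, K, List.map_map]
        refine List.map_congr_left fun f hf => ?_
        exact C.comp'_assoc ((a.tgt_mem hf).trans hl.1) (hm b List.mem_cons_self)
  have := key y.toList x.arr.toList (congrArg Mr.toList h) (fun f hf => (x.tgt_mem hf).trans hg)
  rw [K, opComp_toList, this, K]

theorem opComp_assoc_list (w : List {p : Mr C.Op × C.Op //
      p.1.map (fun f => f.base.1) = p.2.arr.map C.src}) :
    ∀ l : List C.C₁, w.map (fun p => p.1.2.base.1) = l.map C.src →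
    (List.zipWith C.K (w.map fun p => C.opComp p.1.1 p.1.2 p.2) l).flatten =
      (List.zipWith C.K (w.flatMap fun p => p.1.1.toList)
        (List.zipWith C.K (w.map fun p => p.1.2) l).flatten).flatten := by
  induction w with
  | nil => intro l _; simp
  | cons a w ih =>
    intro l hl
    cases l with
    | nil => simp at hl
    | cons b l =>
      rw [List.map_cons, List.map_cons, List.cons.injEq] at hl
      simp only [List.map_cons, List.zipWith_cons_cons, List.flatten_cons, List.flatMap_cons]
      have hlen : a.1.1.toList.length = (C.K a.1.2 b).length := by
        have := congrArg (fun l => l.toList.length) a.2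
        simpa [K, Mr.map] using this
      rw [List.zipWith_append hlen, List.flatten_append, ih l hl.2, K_comp _ _ _ _ _ hl.1]

/-- The T-construction from categories to `Mr`-operads. -/
def toOperad : MrOperad where
  Q₀ := C.C₀
  Q₁ := C.Op
  s := fun x => x.arr.map C.src
  t := fun x => x.base.1
  m := C.opComp
  e := fun c => ⟨Mr.unit (C.one c), (c, Mr.unit ()), by
    rw [Mr.map_unit, C.tgt_one, Mr.D_unit]⟩
  s_m := fun y x h => by
    have hy := Mr.pair_fst (fun f : C.Op => f.base.1) C.src y x.arr h
    conv_rhs => rw [← hy, Mr.map_map]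
    change (Mr.mul (Mr.map C.whisker _)).map C.src = _
    rw [Mr.map_mul, Mr.map_map]
    exact congrArg (fun k => Mr.mul (Mr.map k _)) (funext C.whisker_src)
  t_m := fun _ _ _ => rfl
  s_e := fun c => by rw [Mr.map_unit, C.src_one]
  t_e := fun _ => rfl
  m_e := fun x => by
    refine Op.ext' ((C.opComp_toList _ _ _).trans ?_) rfl
    change (List.zipWith C.K [x] [C.one x.base.1]).flatten = _
    simp only [List.zipWith_cons_cons, List.zipWith_nil_left, List.flatten_cons,
      List.flatten_nil, List.append_nil, K]
    conv_rhs => rw [← List.map_id x.arr.toList]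
    exact List.map_congr_left fun f hf => C.comp'_one (x.tgt_mem hf)
  e_m := fun x h => by
    refine Op.ext' ?_ rfl
    rw [opComp_toList]
    change (List.zipWith C.K ((x.arr.toList.map C.src).map _) x.arr.toList).flatten = _
    generalize x.arr.toList = l
    induction l with
    | nil => rfl
    | cons f l ih =>
      simp only [List.map_cons, List.zipWith_cons_cons, List.flatten_cons]
      rw [ih]
      simp [K, Mr.unit, one_comp']
  assoc := fun w x h₁ h₂ h₃ => by
    refine Op.ext' ?_ rfl
    rw [opComp_toList, opComp_toList, opComp_toList]
    have := C.opComp_assoc_list w.toList x.arr.toList (by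
      have := congrArg Mr.toList h₂
      rw [Mr.map_map] at this
      exact this)
    refine this.trans ?_
    simp only [Mr.mul, Mr.map, List.flatMap_map]

end IntCat

/-- The T-construction from `Mr`-operads to `Mr`-operads. -/
def MrOperad.T (Q : MrOperad) : MrOperad := Q.toCat.toOperad


/-! ## Free symmetric (semi)monoidal groupoids -/

/-- The groupoid `⨆_{n ≥ k} Xⁿ // 𝔖ₙ` of finite sequences, of length at least `k`, of elements of
the set (discrete groupoid) `X`. For `k = 0` it is the free symmetric monoidal groupoid `S X`, and
for `k = 1` it is the free symmetric semimonoidal groupoid `Sʳ X`. -/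
structure FreeSym (k : ℕ) (X : Type) where
  len : ℕ
  le_len : k ≤ len
  val : Fin len → X

namespace FreeSym

variable {k : ℕ} {X Y : Type}

/-- The morphisms are the bijections between positions that preserve the entries. -/
instance : Groupoid.{0} (FreeSym k X) where
  Hom x y := {e : Fin x.len ≃ Fin y.len // ∀ i, y.val (e i) = x.val i}
  id x := ⟨Equiv.refl _, fun _ => rfl⟩
  comp f g := ⟨f.1.trans g.1, fun i => (g.2 _).trans (f.2 i)⟩
  inv f := ⟨f.1.symm, fun i => by rw [← f.2, Equiv.apply_symm_apply]⟩
  inv_comp f := Subtype.ext (Equiv.symm_trans_self f.1)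
  comp_inv f := Subtype.ext (Equiv.self_trans_symm f.1)

/-- The functoriality of `X ↦ FreeSym k X`. -/
def map (f : X → Y) : FreeSym k X ⥤ FreeSym k Y where
  obj x := ⟨x.len, x.le_len, fun i => f (x.val i)⟩
  map e := ⟨e.1, fun i => congrArg f (e.2 i)⟩

/-- The entries of the concatenation of the sequences `f x₁, …, f xₙ`, indexed by pairs of
positions. -/
def entry (f : X → Mr Y) (x : FreeSym k X)
    (p : (i : Fin x.len) × Fin (f (x.val i)).toList.length) : Y :=
  (f (x.val p.1)).toList.get p.2

/-- The bijection on pairs of positions induced by a morphism. -/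
def blockEquiv (f : X → Mr Y) {x y : FreeSym k X} (e : x ⟶ y) :
    ((i : Fin x.len) × Fin (f (x.val i)).toList.length) ≃
      ((i : Fin y.len) × Fin (f (y.val i)).toList.length) :=
  Equiv.sigmaCongr e.1
    (fun i => finCongr (congrArg (fun a => (f a).toList.length) (e.2 i).symm))

theorem entry_blockEquiv (f : X → Mr Y) {x y : FreeSym k X} (e : x ⟶ y)
    (p : (i : Fin x.len) × Fin (f (x.val i)).toList.length) :
    entry f y (blockEquiv f e p) = entry f x p := by
  have aux : ∀ (a b : X) (_ : b = a) (h' : (f a).toList.length = (f b).toList.length)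
      (r : Fin (f a).toList.length),
      (f b).toList.get (finCongr h' r) = (f a).toList.get r := by
    intro a b h h' r; subst h; rfl
  exact aux _ _ (e.2 p.1) _ p.2

/-- For `f : X → Mr Y`, the composite of the functor `FreeSym k X ⥤ FreeSym k (Mr Y)` induced by
`f`, the inclusion of sequences `Mr Y → FreeSym k Y` applied to the entries, and concatenation
`FreeSym k (FreeSym k Y) ⥤ FreeSym k Y`. On objects it sends `x₁, …, xₙ` to the concatenation of
`f x₁, …, f xₙ`, and on morphisms it takes a permutation to the induced permutation of blocks. -/
def bind (f : X → Mr Y) : FreeSym k X ⥤ FreeSym k Y where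
  obj x :=
    { len := ∑ i, (f (x.val i)).toList.length
      le_len := by
        have h : ∑ _i : Fin x.len, 1 ≤ ∑ i, (f (x.val i)).toList.length :=
          Finset.sum_le_sum fun i _ => List.length_pos_iff.2 (f (x.val i)).ne_nil
        simp only [Finset.sum_const, Finset.card_univ, Fintype.card_fin, smul_eq_mul,
          mul_one] at h
        exact x.le_len.trans h
      val := fun j => entry f x (finSigmaFinEquiv.symm j) }
  map {x y} e :=
    ⟨(finSigmaFinEquiv.symm.trans (blockEquiv f e)).trans finSigmaFinEquiv, fun j => by
      change entry f y (finSigmaFinEquiv.symm (finSigmaFinEquiv _)) = _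
      rw [Equiv.symm_apply_apply]
      exact entry_blockEquiv f e _⟩
  map_id x := by
    apply Subtype.ext
    apply Equiv.ext
    intro j
    exact finSigmaFinEquiv.apply_symm_apply j
  map_comp {x y z} e e' := by
    apply Subtype.ext
    apply Equiv.ext
    intro j
    change finSigmaFinEquiv _ = finSigmaFinEquiv (blockEquiv f e'
      (finSigmaFinEquiv.symm (finSigmaFinEquiv _)))
    rw [Equiv.symm_apply_apply]
    rfl

/-- Juxtaposition of sequences. -/
def add : FreeSym k X × FreeSym k X ⥤ FreeSym k X where
  obj x := ⟨x.1.len + x.2.len, x.1.le_len.trans (Nat.le_add_right ..),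
    Fin.append x.1.val x.2.val⟩
  map {x y} e := ⟨(finSumFinEquiv.symm.trans (Equiv.sumCongr e.1.1 e.2.1)).trans finSumFinEquiv,
    fun i => by
      induction i using Fin.addCases with
      | left i => simpa using e.1.2 i
      | right i => simpa using e.2.2 i⟩
  map_id x := by
    apply Subtype.ext
    apply Equiv.ext
    intro i
    induction i using Fin.addCases with
    | left i =>
      change finSumFinEquiv (Equiv.sumCongr (Equiv.refl _) (Equiv.refl _) _) = _
      simp; rfl
    | right i =>
      change finSumFinEquiv (Equiv.sumCongr (Equiv.refl _) (Equiv.refl _) _) = _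
      simp; rfl
  map_comp {x y z} e e' := by
    apply Subtype.ext
    apply Equiv.ext
    intro i
    change finSumFinEquiv _ = finSumFinEquiv (Equiv.sumCongr e'.1.1 e'.2.1
      (finSumFinEquiv.symm (finSumFinEquiv _)))
    rw [Equiv.symm_apply_apply]
    change finSumFinEquiv (Equiv.sumCongr (e.1.1.trans e'.1.1) (e.2.1.trans e'.2.1)
      (finSumFinEquiv.symm i)) = finSumFinEquiv (Equiv.sumCongr e'.1.1 e'.2.1
      (Equiv.sumCongr e.1.1 e.2.1 (finSumFinEquiv.symm i)))
    generalize finSumFinEquiv.symm i = r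
    cases r <;> rfl

end FreeSym

/-! ## Homotopy cardinality of groupoids -/

/-- The set of isomorphism classes. -/
def π₀ (G : Type) [Category.{0} G] : Type := Quotient (isIsomorphicSetoid G)

/-- The isomorphism class of an object. -/
def cls {G : Type} [Category.{0} G] (x : G) : π₀ G := Quotient.mk (isIsomorphicSetoid G) x

/-- A representative of an isomorphism class. -/
noncomputable def rep {G : Type} [Category.{0} G] (c : π₀ G) : G := Quotient.out c

/-- A groupoid is finite if it has finitely many isomorphism classes and finite automorphism
groups. -/
def FiniteGpd (G : Type) [Category.{0} G] : Prop :=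
  Finite (π₀ G) ∧ ∀ x : G, Finite (Aut x)

/-- The homotopy cardinality of a finite groupoid. -/
noncomputable def card (G : Type) [Category.{0} G] : ℚ :=
  ∑ᶠ c : π₀ G, (Nat.card (Aut (rep c)) : ℚ)⁻¹

/-- The homotopy fibre of a functor of groupoids: the objects are pairs of an object `a` and an
isomorphism `p a ⟶ b`. -/
abbrev HFibre {A B : Type} [Category.{0} A] [Category.{0} B] (p : A ⥤ B) (b : B) : Type :=
  CostructuredArrow p b

/-- The rational vector space spanned by the isomorphism classes of a groupoid. -/
abbrev Vec (G : Type) [Category.{0} G] : Type := AddMonoidAlgebra ℚ (π₀ G)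

/-- The basis vector of an isomorphism class. -/
noncomputable def δ {G : Type} [Category.{0} G] (c : π₀ G) : Vec G := AddMonoidAlgebra.single c 1

/-- The linear map out of `Vec G` with given values on the basis. -/
noncomputable def lift {G : Type} [Category.{0} G] {M : Type} [AddCommGroup M] [Module ℚ M]
    (v : π₀ G → M) : Vec G →ₗ[ℚ] M :=
  Finsupp.linearCombination ℚ v ∘ₗ (AddMonoidAlgebra.coeffLinearEquiv ℚ).toLinearMap

/-- The homotopy cardinality `∑_b |A_b| / |Aut b| δ_b` of a functor `p : A ⥤ B` of groupoids. -/
noncomputable def cardMap {A B : Type} [Category.{0} A] [Category.{0} B] (p : A ⥤ B) : Vec B :=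
  ∑ᶠ c : π₀ B, (card (HFibre p (rep c)) / Nat.card (Aut (rep c))) • δ c

/-- The identification of `Vec (A × B)` with `Vec A ⊗ Vec B`. -/
noncomputable def toTensor (A B : Type) [Category.{0} A] [Category.{0} B] :
    Vec (A × B) →ₗ[ℚ] Vec A ⊗[ℚ] Vec B :=
  lift fun c => δ (cls (rep c).1) ⊗ₜ δ (cls (rep c).2)

/-! ## Simplicial groupoids and incidence coalgebras -/

/-- Groupoids `X₀, X₁, X₂, …` with face functors `dᵢ` and degeneracy functors `sᵢ`. -/
structure SimplicialGpd where
  obj : ℕ → Type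
  gpd : ∀ n, Groupoid.{0} (obj n)
  d : ∀ n, Fin (n + 2) → obj (n + 1) ⥤ obj n
  s : ∀ n, Fin (n + 1) → obj n ⥤ obj (n + 1)

attribute [instance] SimplicialGpd.gpd

namespace SimplicialGpd

variable (X : SimplicialGpd)

/-- Local finiteness: `X₁` has finite automorphism groups, and the homotopy fibres of
`s₀ : X₀ ⥤ X₁` and of `d₁ : X₂ ⥤ X₁` are finite. -/
def LocallyFinite : Prop :=
  (∀ x : X.obj 1, Finite (Aut x)) ∧
  (∀ x : X.obj 1, FiniteGpd (HFibre (X.s 0 0) x)) ∧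
  (∀ x : X.obj 1, FiniteGpd (HFibre (X.d 1 1) x))

/-- The functor `Δ` of the incidence coalgebra, sending `s : S ⥤ X₁` to `(d₂, d₀)_! d₁^* s`, where
`d₁^*` is homotopy pullback along `d₁ : X₂ ⥤ X₁`. -/
def comulFunctor {S : Type} [Groupoid.{0} S] (s : S ⥤ X.obj 1) : Comma s (X.d 1 1) ⥤ X.obj 1 × X.obj 1 :=
  Comma.snd s (X.d 1 1) ⋙ (X.d 1 2).prod' (X.d 1 0)

/-- The functor `ε` of the incidence coalgebra, sending `s : S ⥤ X₁` to the homotopy pullback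
`s₀^* s` along `s₀ : X₀ ⥤ X₁`. -/
abbrev counitGpd {S : Type} [Groupoid.{0} S] (s : S ⥤ X.obj 1) : Type := Comma s (X.s 0 0)

/-- The functor from the one-point groupoid that picks an object. -/
abbrev name {G : Type} [Groupoid.{0} G] (x : G) : Discrete PUnit.{1} ⥤ G := Functor.fromPUnit x

/-- The homotopy cardinality of `Δ`: the comultiplication with
`δ_f = |⌜f⌝| ↦ |(d₂, d₀)_! d₁^* ⌜f⌝|`. -/
noncomputable def comul : Vec (X.obj 1) →ₗ[ℚ] Vec (X.obj 1) ⊗[ℚ] Vec (X.obj 1) :=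
  lift fun c => toTensor _ _ (cardMap (X.comulFunctor (name (rep c))))

/-- The homotopy cardinality of `ε`: the counit with `δ_f = |⌜f⌝| ↦ |s₀^* ⌜f⌝|`. -/
noncomputable def counit : Vec (X.obj 1) →ₗ[ℚ] ℚ :=
  lift fun c => card (X.counitGpd (name (rep c)))

end SimplicialGpd

/-! ## The product given by juxtaposition -/

namespace FreeSym

variable {k : ℕ} {X : Type}

theorem cls_eq {x y : FreeSym k X} (e : Fin x.len ≃ Fin y.len)
    (h : ∀ i, y.val (e i) = x.val i) : cls x = cls y :=
  Quotient.sound (s := isIsomorphicSetoid _)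
    ((Groupoid.isIsomorphic_iff_nonempty_hom (X := x) (Y := y)).2 ⟨⟨e, h⟩⟩)

/-- The operation on isomorphism classes induced by juxtaposition. -/
instance : Add (π₀ (FreeSym k X)) where
  add := Quotient.map₂ (fun x y => add.obj (x, y)) (fun _ _ ⟨e⟩ _ _ ⟨e'⟩ =>
    ⟨add.mapIso (Iso.prod e e')⟩)

theorem cls_add (x y : FreeSym k X) : cls x + cls y = cls (add.obj (x, y)) := rfl

instance : AddCommSemigroup (π₀ (FreeSym k X)) where
  add_assoc := by
    rintro ⟨x⟩ ⟨y⟩ ⟨z⟩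
    refine cls_eq (finCongr (Nat.add_assoc ..)) fun i => ?_
    exact (congrFun (Fin.append_assoc x.val y.val z.val) i).symm
  add_comm := by
    rintro ⟨x⟩ ⟨y⟩
    refine cls_eq finAddFlip fun i => ?_
    change Fin.append y.val x.val _ = Fin.append x.val y.val i
    induction i using Fin.addCases with
    | left i =>
      exact (congrArg _ (finAddFlip_apply_castAdd i y.len)).trans
        ((Fin.append_right ..).trans (Fin.append_left ..).symm)
    | right i =>
      exact (congrArg _ (finAddFlip_apply_natAdd i x.len)).trans
        ((Fin.append_left ..).trans (Fin.append_right ..).symm)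

/-- The class of the empty sequence. -/
instance : Zero (π₀ (FreeSym 0 X)) := ⟨cls ⟨0, le_rfl, Fin.elim0⟩⟩

/-- For `k = 0` the empty sequence is a unit. -/
instance : AddCommMonoid (π₀ (FreeSym 0 X)) where
  __ := (inferInstance : AddCommSemigroup (π₀ (FreeSym 0 X)))
  zero_add := by
    rintro ⟨x⟩
    refine cls_eq (finCongr (Nat.zero_add _)) fun i => ?_
    exact (congrFun (Fin.append_left_nil (Fin.elim0 : Fin 0 → X) x.val rfl) i).symm
  add_zero := by
    rintro ⟨x⟩
    refine cls_eq (finCongr (Nat.add_zero _)) fun i => ?_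
    exact (congrFun (Fin.append_right_nil x.val (Fin.elim0 : Fin 0 → X) rfl) i).symm
  nsmul := nsmulRec

end FreeSym

/-! ## The two-sided bar construction -/

/-- A set over `B`. -/
structure SetOver (B : Type) where
  E : Type
  p : E → B

/-- A map of sets over `B`. -/
def SetOver.Hom {B : Type} (X Y : SetOver B) : Type := {f : X.E → Y.E // ∀ a, Y.p (f a) = X.p a}

namespace MrOperad

variable (Q : MrOperad)

/-- The monad on sets over `Q₀` defined by an operad: `X` is sent to `Mr X ×_{Mr Q₀} Q₁`,
over `Q₀` via the output colour. -/
def mon (X : SetOver Q.Q₀) : SetOver Q.Q₀ where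
  E := {p : Mr X.E × Q.Q₁ // p.1.map X.p = Q.s p.2}
  p := fun p => Q.t p.1.2

/-- The functoriality of `mon`. -/
def monMap {X Y : SetOver Q.Q₀} (f : X.Hom Y) : (Q.mon X).Hom (Q.mon Y) :=
  ⟨fun p => ⟨(p.1.1.map f.1, p.1.2), by
    rw [Mr.map_map, show Y.p ∘ f.1 = X.p from funext f.2]; exact p.2⟩, fun _ => rfl⟩

/-- The multiplication of `mon`, on underlying sets: concatenation, and composition in the
operad. -/
def monMulFun (X : SetOver Q.Q₀) (p : (Q.mon (Q.mon X)).E) : (Q.mon X).E :=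
  ⟨(Mr.mul (p.1.1.map fun q : (Q.mon X).E => q.1.1),
    Q.m (p.1.1.map fun q : (Q.mon X).E => q.1.2) p.1.2 (by rw [Mr.map_map]; exact p.2)), by
    rw [Q.s_m, Mr.map_mul, Mr.map_map, Mr.map_map]
    exact congrArg (fun k => Mr.mul (p.1.1.map k)) (funext fun q : (Q.mon X).E => q.2)⟩

/-- The multiplication of `mon`. -/
def monMul (X : SetOver Q.Q₀) : (Q.mon (Q.mon X)).Hom (Q.mon X) :=
  ⟨Q.monMulFun X, fun _ => Q.t_m ..⟩

/-- The unit of `mon`. -/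
def monUnit (X : SetOver Q.Q₀) : X.Hom (Q.mon X) :=
  ⟨fun x => ⟨(Mr.unit x, Q.e (X.p x)), by rw [Q.s_e]; rfl⟩, fun _ => Q.t_e _⟩

/-- The `n`-fold iterate of `mon` on the terminal object `Q₀ → Q₀`. -/
def tree : ℕ → SetOver Q.Q₀
  | 0 => ⟨Q.Q₀, fun c => c⟩
  | n + 1 => Q.mon (tree n)

/-- The inner and bottom face maps: `d₀` is given by the algebra structure `Q.mon 1 → 1` and the
others by the multiplication of the monad. -/
def treeFace : ∀ n, Fin (n + 1) → (Q.tree (n + 1)).Hom (Q.tree n)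
  | 0, _ => ⟨fun p => Q.t p.1.2, fun _ => rfl⟩
  | n + 1, i => Fin.lastCases (motive := fun _ => (Q.tree (n + 2)).Hom (Q.tree (n + 1)))
      (Q.monMul (Q.tree n)) (fun j => Q.monMap (treeFace n j)) i

/-- The degeneracy maps, given by the unit of the monad. -/
def treeDegen : ∀ n, Fin (n + 1) → (Q.tree n).Hom (Q.tree (n + 1))
  | 0, _ => Q.monUnit (Q.tree 0)
  | n + 1, i => Fin.lastCases (motive := fun _ => (Q.tree (n + 1)).Hom (Q.tree (n + 2)))
      (Q.monUnit (Q.tree (n + 1))) (fun j => Q.monMap (treeDegen n j)) i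

/-- The two-sided bar construction of `Q` relative to the free symmetric monoidal (`k = 0`) or
semimonoidal (`k = 1`) groupoid monad. The groupoid of `n`-simplices is `FreeSym k` of the set of
`n`-level trees of operations; the top face map deletes the root operations. -/
def bar (k : ℕ) : SimplicialGpd where
  obj n := FreeSym k (Q.tree n).E
  gpd _ := inferInstance
  d n := Fin.lastCases (FreeSym.bind fun p : (Q.mon (Q.tree n)).E => p.1.1)
    (fun i => FreeSym.map (Q.treeFace n i).1)
  s n i := FreeSym.map (Q.treeDegen n i).1

/-- The homotopy cardinality of the incidence bialgebra of `Q.bar k`: the span of the isomorphism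
classes of `1`-simplices, with product `δ_a δ_b = δ_{a + b}` given by juxtaposition (unital if
`k = 0`), comultiplication `(Q.bar k).comul` and counit `(Q.bar k).counit`. -/
abbrev Inc (k : ℕ) : Type := Vec ((Q.bar k).obj 1)

instance (k : ℕ) : AddCommSemigroup (π₀ ((Q.bar k).obj 1)) :=
  inferInstanceAs (AddCommSemigroup (π₀ (FreeSym k (Q.tree 1).E)))

instance : AddCommMonoid (π₀ ((Q.bar 0).obj 1)) :=
  inferInstanceAs (AddCommMonoid (π₀ (FreeSym 0 (Q.tree 1).E)))

end MrOperad

/-! ## Power series in noncommuting variables and plethystic substitution -/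

/-- Formal power series with rational coefficients in noncommuting variables `x₁, x₂, …`: a series
is the family of its coefficients at the monomials `x_w = x_{w₁} ⋯ x_{wₙ}`. -/
def NCSeries : Type := List ℕ+ → ℚ

namespace NCSeries

/-- The product of power series. -/
instance : Mul NCSeries :=
  ⟨fun F G w => ∑ i ∈ Finset.range (w.length + 1), F (w.take i) * G (w.drop i)⟩

instance : One NCSeries := ⟨fun w => if w = [] then 1 else 0⟩

/-- The substitution `G(H₁, H₂, …) = ∑_w g_w H_{w₁} ⋯ H_{wₙ}`, for series `H₁, H₂, …` for which
every coefficient of the sum has finitely many nonzero contributions. -/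
noncomputable def subst (G : NCSeries) (H : ℕ+ → NCSeries) : NCSeries :=
  fun v => ∑ᶠ w : List ℕ+, G w * (w.map H).prod v

/-- The series `F_k(x₁, x₂, …) = F(x_k, x_{2k}, …)`. -/
noncomputable def dilate (k : ℕ+) (F : NCSeries) : NCSeries :=
  fun v => ∑ᶠ (w : List ℕ+) (_ : w.map (fun i => k * i) = v), F w

/-- The plethystic substitution `G ⊛ F = G(F₁, F₂, …)`. -/
noncomputable def pleth (G F : NCSeries) : NCSeries := subst G (fun k => dilate k F)

/-- The variable `x₁` as a power series. -/
def x₁ : NCSeries := fun w => if w = [1] then 1 else 0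

end NCSeries

/-- Power series without constant term. -/
def NCSeries₀ : Type := {F : NCSeries // F [] = 0}

/-! ## The linear plethystic bialgebra with noncommuting variables -/

/-- The set `W` of nonempty words of positive integers. -/
abbrev W : Type := Mr ℕ+

/-- The polynomial algebra on commuting generators `a_ω`, for `ω ∈ W`. -/
abbrev Plin : Type := MvPolynomial W ℚ

namespace Plin

/-- Evaluation of a polynomial at a power series without constant term; the generator `a_ω` gives
the coefficient of `x_ω`. -/
noncomputable def eval (F : NCSeries₀) : Plin →ₐ[ℚ] ℚ :=
  MvPolynomial.aeval fun ω => F.1 ω.toList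

/-- Evaluation of an element of `Plin ⊗ Plin` at a pair of power series. -/
noncomputable def eval₂ (F G : NCSeries₀) : Plin ⊗[ℚ] Plin →ₐ[ℚ] ℚ :=
  Algebra.TensorProduct.lift (eval F) (eval G) fun _ _ => Commute.all ..

/-- The comultiplication is dual to plethystic substitution:
`Δ(a_ω)(F, G) = a_ω(G ⊛ F)`. -/
def IsPlethysticComul (Δ : Plin →ₐ[ℚ] Plin ⊗[ℚ] Plin) : Prop :=
  ∀ (ω : W) (F G : NCSeries₀),
    eval₂ F G (Δ (MvPolynomial.X ω)) = NCSeries.pleth G.1 F.1 ω.toList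

/-- The counit, `ε(a_ω) = a_ω(x₁)`. -/
noncomputable def counit : Plin →ₐ[ℚ] ℚ :=
  eval ⟨NCSeries.x₁, if_neg (by simp)⟩

end Plin

/-- The axioms of a (counital coassociative, unital associative) bialgebra for an algebra `A` with
given comultiplication and counit. -/
structure IsBialgebra (A : Type) [CommSemiring A] [Algebra ℚ A] (Δ : A →ₗ[ℚ] A ⊗[ℚ] A)
    (ε : A →ₗ[ℚ] ℚ) : Prop where
  coassoc : (TensorProduct.assoc ℚ A A A).toLinearMap ∘ₗ Δ.rTensor A ∘ₗ Δ = Δ.lTensor A ∘ₗ Δ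
  counit_left : ∀ a, TensorProduct.lid ℚ A (ε.rTensor A (Δ a)) = a
  counit_right : ∀ a, TensorProduct.rid ℚ A (ε.lTensor A (Δ a)) = a
  comul_one : Δ 1 = 1
  comul_mul : ∀ a b, Δ (a * b) = Δ a * Δ b
  counit_one : ε 1 = 1
  counit_mul : ∀ a b, ε (a * b) = ε a * ε b

end Pleth

open Pleth

namespace Pleth

/-! ## Splittings and the order on words -/

/-! Both comultiplications enumerate the same factorizations of words.

On the polynomial side, the coefficient of x_w in G ⊛ F is the sum over u of g_u M_{u,w}(F), where
M_{u,w} (`mat u w`) is the coefficient of x_w in F_{u₁}⋯F_{uₙ}, a polynomial in the coefficients of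
F. It vanishes unless u is no longer than w and its letters are bounded by letters of w
(`dom_of_mat_ne_zero`). Hence the sum is finite and Δ(a_w) = ∑_u M_{u,w} ⊗ a_u. Coassociativity
follows from Δ(M_{u,w}) = ∑_v M_{v,w} ⊗ M_{u,v} (`comul_mat`): the coefficients of products of
dilates multiply like matrices under substitution. The counit evaluates at F = x₁, where F_k = x_k
and M becomes the identity matrix (`counit_mat`). Uniqueness of Δ holds because a polynomial over ℚ
is determined by its values (`eval₂_injective`).

On the bar side, the category obtained from `Ass` is the multiplicative monoid of positive integers
(`size_bijective`, `size_comp'`). So a one-level tree is a word, and a two-level tree is a root word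
u with a word y_i for each letter; it composes to the concatenation of the words u_i y_i
(`word_treeComp`). The two-level trees over w are thus the factorizations of w, and these also index
the monomials of the M_{u,w} (`mat_eq_sum`). For a map of sets, the homotopy fibres of the induced
functor on free symmetric groupoids are equivalent to sets of choices of preimages of the entries
(`isDiscreteOn_fibrePoint`), so no symmetry factors survive in the homotopy cardinality
(`IsDiscreteOn.cardMap_eq`). Finally, isomorphism classes of sequences of words are monomials in the
a_ω, and juxtaposition is their product. The empty sequence is the monomial 1, which accounts for
the difference between the unital and the nonunital version. -/

/-- The ways to write a word as a concatenation of two words. -/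
def splits (w : List ℕ+) : Finset (List ℕ+ × List ℕ+) :=
  (Finset.range (w.length + 1)).image fun i => (w.take i, w.drop i)

theorem mem_splits {w : List ℕ+} {p : List ℕ+ × List ℕ+} : p ∈ splits w ↔ p.1 ++ p.2 = w := by
  simp only [splits, Finset.mem_image, Finset.mem_range]
  constructor
  · rintro ⟨i, _, rfl⟩
    exact List.take_append_drop i w
  · rintro rfl
    exact ⟨p.1.length, by simp, by simp⟩

/-- The cut position is the length of the first part, so distinct positions give distinct
splittings. The range form is the one in the product of series. -/
theorem sum_splits {R : Type*} [AddCommMonoid R] (w : List ℕ+) (f : List ℕ+ × List ℕ+ → R) :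
    ∑ p ∈ splits w, f p = ∑ i ∈ Finset.range (w.length + 1), f (w.take i, w.drop i) := by
  refine Finset.sum_image fun i hi j hj h => ?_
  have := congrArg (fun p => p.1.length) h
  simp only [Finset.coe_range, Set.mem_Iio] at hi hj
  simp only [List.length_take] at this
  omega

theorem sum_splits_map {R : Type*} [AddCommMonoid R] (w : List ℕ+) (g : ℕ+ → ℕ+)
    (f : List ℕ+ × List ℕ+ → R) :
    ∑ p ∈ splits (w.map g), f p = ∑ p ∈ splits w, f (p.1.map g, p.2.map g) := by
  simp only [sum_splits, List.length_map, List.map_take, List.map_drop]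

/-- `u` is at most as long as `w`, and each letter of `u` is bounded by some letter of `w`. -/
def Dom (u w : List ℕ+) : Prop := u.length ≤ w.length ∧ ∀ x ∈ u, ∃ y ∈ w, x ≤ y

theorem Dom.refl (w : List ℕ+) : Dom w w := ⟨le_rfl, fun x hx => ⟨x, hx, le_rfl⟩⟩

theorem Dom.trans {u v w : List ℕ+} (h : Dom u v) (h' : Dom v w) : Dom u w :=
  ⟨h.1.trans h'.1, fun x hx => by
    obtain ⟨y, hy, hxy⟩ := h.2 x hx
    obtain ⟨z, hz, hyz⟩ := h'.2 y hy
    exact ⟨z, hz, hxy.trans hyz⟩⟩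

theorem Dom.append {u v u' v' : List ℕ+} (h : Dom u v) (h' : Dom u' v') :
    Dom (u ++ u') (v ++ v') :=
  ⟨by simpa using Nat.add_le_add h.1 h'.1, fun x hx => by
    rcases List.mem_append.1 hx with hx | hx
    · obtain ⟨y, hy, hxy⟩ := h.2 x hx
      exact ⟨y, List.mem_append_left _ hy, hxy⟩
    · obtain ⟨y, hy, hxy⟩ := h'.2 x hx
      exact ⟨y, List.mem_append_right _ hy, hxy⟩⟩

theorem Dom.of_mem_splits {w : List ℕ+} {p : List ℕ+ × List ℕ+} (h : p ∈ splits w) :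
    Dom p.1 w ∧ Dom p.2 w := by
  rw [mem_splits] at h
  subst h
  exact ⟨⟨by simp, fun x hx => ⟨x, by simp [hx], le_rfl⟩⟩,
    ⟨by simp, fun x hx => ⟨x, by simp [hx], le_rfl⟩⟩⟩

/-- Such words have bounded length over the finite alphabet of letters up to the maximum of w. All
finiteness of the coefficient sums comes from here. -/
theorem finite_dom (w : List ℕ+) : {u | Dom u w}.Finite := by
  have hN : ∃ N : ℕ+, ∀ y ∈ w, y ≤ N := by
    induction w with
    | nil => exact ⟨1, by simp⟩
    | cons a l ih =>
      obtain ⟨N, h⟩ := ih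
      refine ⟨max a N, fun y hy => ?_⟩
      rcases List.mem_cons.1 hy with rfl | hy
      · exact le_max_left ..
      · exact (h y hy).trans (le_max_right ..)
  obtain ⟨N, hN⟩ := hN
  have hf : Finite {x : ℕ+ // x ≤ N} := (Set.finite_Iic N).to_subtype
  refine ((List.finite_length_le {x : ℕ+ // x ≤ N} w.length).image
    (List.map Subtype.val)).subset fun u hu => ?_
  have h : ∀ x ∈ u, x ≤ N := fun x hx => by
    obtain ⟨y, hy, hxy⟩ := hu.2 x hx
    exact hxy.trans (hN y hy)
  exact ⟨u.attach.map fun x => ⟨x.1, h x.1 x.2⟩, by simpa using hu.1, by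
    simp [List.map_map, Function.comp_def]⟩

/-- The finite set of words dominated by `w`. -/
noncomputable def below (w : List ℕ+) : Finset (List ℕ+) := (finite_dom w).toFinset

theorem mem_below {u w : List ℕ+} : u ∈ below w ↔ Dom u w := by simp [below]

theorem map_mul_injective (k : ℕ+) : Function.Injective (List.map (fun i : ℕ+ => k * i)) :=
  List.map_injective_iff.2 (mul_right_injective k)

/-! ## The matrix of a generic plethystic substitution -/

namespace Plin

/-- The generator of a word, extended by zero to the empty word. -/
noncomputable def gen (w : List ℕ+) : Plin := if h : w ≠ [] then MvPolynomial.X ⟨w, h⟩ else 0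

theorem gen_toList (ω : W) : gen ω.toList = MvPolynomial.X ω := dif_pos ω.ne_nil

theorem gen_nil : gen [] = 0 := dif_neg (by simp)

/-- The coefficient of a word in the generic series dilated by `k`. -/
noncomputable def dil (k : ℕ+) (v : List ℕ+) : Plin :=
  Function.extend (List.map (fun i : ℕ+ => k * i)) gen 0 v

theorem dil_map (k : ℕ+) (v : List ℕ+) : dil k (v.map fun i => k * i) = gen v :=
  (map_mul_injective k).extend_apply ..

theorem dil_eq_zero {k : ℕ+} {v : List ℕ+} (h : ¬ ∃ u : List ℕ+, u.map (fun i => k * i) = v) :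
    dil k v = 0 :=
  Function.extend_apply' _ _ _ h

theorem exists_of_dil_ne_zero {k : ℕ+} {v : List ℕ+} (h : dil k v ≠ 0) :
    ∃ u : List ℕ+, u ≠ [] ∧ u.map (fun i => k * i) = v := by
  by_cases hv : ∃ u : List ℕ+, u.map (fun i => k * i) = v
  · obtain ⟨u, rfl⟩ := hv
    refine ⟨u, ?_, rfl⟩
    rintro rfl
    exact h ((dil_map k []).trans gen_nil)
  · exact absurd (dil_eq_zero hv) h

theorem dil_one (v : List ℕ+) : dil 1 v = gen v := by
  conv_lhs => rw [← List.map_id v]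
  simpa using dil_map 1 v

theorem dil_mul_map (k j : ℕ+) (v : List ℕ+) :
    dil (k * j) (v.map fun i => k * i) = dil j v := by
  have e : ∀ u : List ℕ+, u.map (fun i => k * j * i) =
      (u.map fun i => j * i).map fun i => k * i := fun u => by
    simp [List.map_map, Function.comp_def, mul_assoc]
  by_cases h : ∃ u : List ℕ+, u.map (fun i => j * i) = v
  · obtain ⟨u, rfl⟩ := h
    rw [← e, dil_map, dil_map]
  · rw [dil_eq_zero h, dil_eq_zero]
    rintro ⟨u, hu⟩
    exact h ⟨u, map_mul_injective k ((e u).symm.trans hu)⟩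

/-- The coefficient of `x_w` in `F_{u₁} F_{u₂} ⋯`, for the generic series `F`. -/
noncomputable def mat : List ℕ+ → List ℕ+ → Plin
  | [], w => if w = [] then 1 else 0
  | k :: u, w => ∑ p ∈ splits w, dil k p.1 * mat u p.2

/-- The generic series has no constant term, so v has at least one letter, and that letter is a
multiple of k, hence at least k. -/
theorem dom_of_dil_ne_zero {k : ℕ+} {v : List ℕ+} (h : dil k v ≠ 0) : Dom [k] v := by
  obtain ⟨u, hu, rfl⟩ := exists_of_dil_ne_zero h
  obtain ⟨a, u, rfl⟩ := List.exists_cons_of_ne_nil hu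
  refine ⟨by simp, fun x hx => ⟨k * a, by simp, ?_⟩⟩
  rw [List.mem_singleton.1 hx]
  exact le_mul_of_one_le_right' one_le

theorem dom_of_mat_ne_zero {u w : List ℕ+} (h : mat u w ≠ 0) : Dom u w := by
  induction u generalizing w with
  | nil => exact ⟨by simp, by simp⟩
  | cons k u ih =>
    obtain ⟨p, hp, hne⟩ := Finset.exists_ne_zero_of_sum_ne_zero h
    rw [← mem_splits.1 hp]
    exact (dom_of_dil_ne_zero (left_ne_zero_of_mul hne)).append (ih (right_ne_zero_of_mul hne))

theorem mat_nil_of_ne {w : List ℕ+} (h : w ≠ []) : mat [] w = 0 := if_neg h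

theorem mat_singleton (k : ℕ+) (w : List ℕ+) : mat [k] w = dil k w := by
  rw [mat, Finset.sum_eq_single (w, [])]
  · simp [mat]
  · rintro ⟨p, q⟩ hp hne
    have hp := mem_splits.1 hp
    have : q ≠ [] := by
      rintro rfl
      simp at hp
      exact hne (by rw [hp])
    simp [mat, this]
  · intro h
    exact absurd (mem_splits.2 (by simp)) h

/-- Splitting the splittings on the left or on the right. -/
theorem sum_splits_assoc {R : Type*} [AddCommMonoid R] (w : List ℕ+)
    (f : List ℕ+ → List ℕ+ → List ℕ+ → R) :
    ∑ p ∈ splits w, ∑ q ∈ splits p.1, f q.1 q.2 p.2 =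
      ∑ p ∈ splits w, ∑ q ∈ splits p.2, f p.1 q.1 q.2 := by
  rw [Finset.sum_sigma', Finset.sum_sigma']
  refine Finset.sum_bij' (fun x _ => ⟨(x.2.1, x.2.2 ++ x.1.2), (x.2.2, x.1.2)⟩)
    (fun x _ => ⟨(x.1.1 ++ x.2.1, x.2.2), (x.1.1, x.2.1)⟩) ?_ ?_ ?_ ?_ ?_
  · rintro ⟨⟨a, b⟩, c, d⟩ h
    simp only [Finset.mem_sigma, mem_splits] at h ⊢
    obtain ⟨rfl, rfl⟩ := h
    simp
  · rintro ⟨⟨a, b⟩, c, d⟩ h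
    simp only [Finset.mem_sigma, mem_splits] at h ⊢
    obtain ⟨rfl, rfl⟩ := h
    simp
  · rintro ⟨⟨a, b⟩, c, d⟩ h
    simp only [Finset.mem_sigma, mem_splits] at h ⊢
    obtain ⟨rfl, rfl⟩ := h
    rfl
  · rintro ⟨⟨a, b⟩, c, d⟩ h
    simp only [Finset.mem_sigma, mem_splits] at h ⊢
    obtain ⟨rfl, rfl⟩ := h
    rfl
  · intros
    rfl

/-- The product of series over a concatenated index word is the product of the two partial products.
-/
theorem mat_append (u u' w : List ℕ+) :
    mat (u ++ u') w = ∑ p ∈ splits w, mat u p.1 * mat u' p.2 := by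
  induction u generalizing w with
  | nil =>
    rw [List.nil_append, Finset.sum_eq_single ([], w)]
    · simp [mat]
    · rintro ⟨p, q⟩ hp hne
      have hp := mem_splits.1 hp
      have : p ≠ [] := by
        rintro rfl
        exact hne (by rw [← hp]; rfl)
      simp [mat, this]
    · intro h
      exact absurd (mem_splits.2 (by simp)) h
  | cons k u ih =>
    simp only [List.cons_append, mat, ih, Finset.mul_sum, Finset.sum_mul, ← mul_assoc]
    exact (sum_splits_assoc w fun a b c => dil k a * mat u b * mat u' c).symm

/-- Dilating the variables by k turns F_j into F_{kj}, so it only renames the monomials. With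
`mat_map_eq_zero`, which handles monomials not in the renamed variables, this makes substitution
commute with dilation. -/
theorem mat_map_map (k : ℕ+) (u w : List ℕ+) :
    mat (u.map fun i => k * i) (w.map fun i => k * i) = mat u w := by
  induction u generalizing w with
  | nil => simp [mat]
  | cons j u ih => simp only [List.map_cons, mat, sum_splits_map, dil_mul_map, ih]

theorem mat_map_eq_zero {k : ℕ+} {w : List ℕ+}
    (h : ¬ ∃ v : List ℕ+, v.map (fun i => k * i) = w) (u : List ℕ+) :
    mat (u.map fun i => k * i) w = 0 := by
  by_contra hne
  apply h
  clear h
  induction u generalizing w with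
  | nil =>
    refine ⟨[], ?_⟩
    by_contra h
    exact hne (mat_nil_of_ne (Ne.symm h))
  | cons j u ih =>
    obtain ⟨p, hp, hne⟩ := Finset.exists_ne_zero_of_sum_ne_zero hne
    obtain ⟨y, _, hy⟩ := exists_of_dil_ne_zero (left_ne_zero_of_mul hne)
    obtain ⟨z, hz⟩ := ih (right_ne_zero_of_mul hne)
    refine ⟨y.map (fun i => j * i) ++ z, ?_⟩
    rw [← mem_splits.1 hp, List.map_append, hz, ← hy, List.map_map]
    simp [Function.comp_def, mul_assoc]

/-! ## The comultiplication -/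

/-- The comultiplication of the linear plethystic bialgebra. -/
noncomputable def comul : Plin →ₐ[ℚ] Plin ⊗[ℚ] Plin :=
  MvPolynomial.aeval fun ω => ∑ u ∈ below ω.toList, mat u ω.toList ⊗ₜ gen u

/-- Only the support of `mat · w` contributes. This frees the index set, so that sums for different
words can be taken over one common finite set. -/
theorem sum_mat_tmul {M : Type*} [AddCommGroup M] [Module ℚ M] {w : List ℕ+}
    {T T' : Finset (List ℕ+)} (hT : ∀ u, mat u w ≠ 0 → u ∈ T) (hT' : ∀ u, mat u w ≠ 0 → u ∈ T')
    (f : List ℕ+ → M) :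
    ∑ u ∈ T, mat u w ⊗ₜ[ℚ] f u = ∑ u ∈ T', mat u w ⊗ₜ[ℚ] f u := by
  have h₁ : ∑ u ∈ T ∩ T', mat u w ⊗ₜ[ℚ] f u = ∑ u ∈ T, mat u w ⊗ₜ[ℚ] f u :=
    Finset.sum_subset Finset.inter_subset_left fun u hu hu' => by
      by_contra hne
      have : mat u w ≠ 0 := fun h => hne (by rw [h, TensorProduct.zero_tmul])
      exact hu' (Finset.mem_inter.2 ⟨hu, hT' u this⟩)
  have h₂ : ∑ u ∈ T ∩ T', mat u w ⊗ₜ[ℚ] f u = ∑ u ∈ T', mat u w ⊗ₜ[ℚ] f u :=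
    Finset.sum_subset Finset.inter_subset_right fun u hu hu' => by
      by_contra hne
      have : mat u w ≠ 0 := fun h => hne (by rw [h, TensorProduct.zero_tmul])
      exact hu' (Finset.mem_inter.2 ⟨hT u this, hu⟩)
  exact h₁.symm.trans h₂

theorem mem_below_of_mat {u v w : List ℕ+} (h : mat u v ≠ 0) (hv : Dom v w) : u ∈ below w :=
  mem_below.2 ((dom_of_mat_ne_zero h).trans hv)

theorem comul_gen {w : List ℕ+} {T : Finset (List ℕ+)} (hT : ∀ u, mat u w ≠ 0 → u ∈ T) :
    comul (gen w) = ∑ u ∈ T, mat u w ⊗ₜ gen u := by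
  rcases eq_or_ne w [] with rfl | h
  -- For the empty word the only possible contribution is from u = [], where the generator is zero
  -- by convention.
  · rw [gen_nil, map_zero]
    refine (Finset.sum_eq_zero fun u _ => ?_).symm
    by_cases hu : mat u [] = 0
    · rw [hu, TensorProduct.zero_tmul]
    · have : u = [] := by simpa using (dom_of_mat_ne_zero hu).1
      rw [this, gen_nil, TensorProduct.tmul_zero]
  · rw [gen, dif_pos h, comul, MvPolynomial.aeval_X]
    exact sum_mat_tmul (fun u hu => mem_below_of_mat hu (Dom.refl w)) hT gen

/-- This is the identity (G ⊛ F)_k = G_k(F₁, F₂, …), read off at the coefficient of x_w. -/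
theorem comul_dil {k : ℕ+} {w : List ℕ+} {T : Finset (List ℕ+)}
    (hT : ∀ u, mat u w ≠ 0 → u ∈ T) :
    comul (dil k w) = ∑ u ∈ T, mat u w ⊗ₜ dil k u := by
  by_cases h : ∃ v : List ℕ+, v.map (fun i => k * i) = w
  · obtain ⟨v, rfl⟩ := h
    -- Terms whose word is not a multiple of k vanish, so the sum can be pulled back along
    -- multiplication by k.
    rw [dil_map, ← Finset.sum_preimage (List.map fun i => k * i) T (map_mul_injective k).injOn
      (fun u => mat u (v.map fun i => k * i) ⊗ₜ dil k u) fun u _ hu => by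
        rw [dil_eq_zero hu, TensorProduct.tmul_zero]]
    simp only [mat_map_map, dil_map]
    refine comul_gen fun u hu => Finset.mem_preimage.2 (hT _ ?_)
    rwa [mat_map_map]
  · rw [dil_eq_zero h, map_zero]
    refine (Finset.sum_eq_zero fun u _ => ?_).symm
    by_cases hu : ∃ v : List ℕ+, v.map (fun i => k * i) = u
    · obtain ⟨v, rfl⟩ := hu
      rw [mat_map_eq_zero h, TensorProduct.zero_tmul]
    · rw [dil_eq_zero hu, TensorProduct.tmul_zero]

theorem sum_below_splits {M : Type*} [AddCommMonoid M] (w : List ℕ+)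
    (f : List ℕ+ × List ℕ+ → M) (hf : ∀ p, ¬ Dom (p.1 ++ p.2) w → f p = 0) :
    ∑ v ∈ below w, ∑ q ∈ splits v, f q = ∑ q ∈ below w ×ˢ below w, f q := by
  rw [← Finset.sum_biUnion]
  · refine Finset.sum_subset (fun q hq => ?_) fun q _ hq => hf q fun h => hq ?_
    · obtain ⟨v, hv, hq⟩ := Finset.mem_biUnion.1 hq
      have := Dom.of_mem_splits hq
      rw [mem_below] at hv
      exact Finset.mem_product.2 ⟨mem_below.2 (this.1.trans hv), mem_below.2 (this.2.trans hv)⟩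
    · exact Finset.mem_biUnion.2 ⟨_, mem_below.2 h, mem_splits.2 rfl⟩
  · intro v _ v' _ hne
    refine Finset.disjoint_left.2 fun q hq hq' => hne ?_
    rw [← mem_splits.1 hq, ← mem_splits.1 hq']

/-- Since `comul` is multiplicative, it acts on each factor of F_{u₁}⋯F_{uₙ} through `comul_dil`. In
the left tensor leg the sum over splittings of w is collected by `mat_append`; in the right leg the
pairs of words are collected according to their concatenation v. -/
theorem comul_mat (u w : List ℕ+) :
    comul (mat u w) = ∑ v ∈ below w, mat v w ⊗ₜ mat u v := by
  induction u generalizing w with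
  | nil =>
    have h0 : ([] : List ℕ+) ∈ below w := mem_below.2 ⟨by simp, by simp⟩
    rw [Finset.sum_eq_single_of_mem _ h0 fun v _ hv => by
      rw [mat_nil_of_ne hv, TensorProduct.tmul_zero]]
    by_cases hw : w = [] <;> simp [mat, hw, Algebra.TensorProduct.one_def]
  | cons k u ih =>
    -- Both inner sums are enlarged to `below w`, so the index set no longer depends on the
    -- splitting and the sums can be interchanged.
    have step : ∀ p ∈ splits w, comul (dil k p.1 * mat u p.2) =
        ∑ q ∈ below w ×ˢ below w,
          (mat q.1 p.1 * mat q.2 p.2) ⊗ₜ[ℚ] (dil k q.1 * mat u q.2) := fun p hp => by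
      have hd := Dom.of_mem_splits hp
      rw [map_mul, comul_dil fun v hv => mem_below_of_mat hv hd.1, ih,
        sum_mat_tmul (fun v hv => mem_below_of_mat hv (Dom.refl _))
          (fun v hv => mem_below_of_mat hv hd.2) (mat u), Finset.sum_mul_sum,
        ← Finset.sum_product']
      simp only [Algebra.TensorProduct.tmul_mul_tmul]
    rw [mat, map_sum, Finset.sum_congr rfl step, Finset.sum_comm]
    simp only [← TensorProduct.sum_tmul, ← mat_append]
    rw [← sum_below_splits w (fun q => mat (q.1 ++ q.2) w ⊗ₜ[ℚ] (dil k q.1 * mat u q.2))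
      fun q hq => by
        rw [not_not.1 fun h => hq (dom_of_mat_ne_zero h), TensorProduct.zero_tmul]]
    refine Finset.sum_congr rfl fun v _ => ?_
    rw [mat, TensorProduct.tmul_sum]
    refine Finset.sum_congr rfl fun q hq => ?_
    rw [mem_splits.1 hq]

theorem comul_X (ω : W) : comul (MvPolynomial.X ω) =
    ∑ u ∈ below ω.toList, mat u ω.toList ⊗ₜ gen u := by
  rw [comul, MvPolynomial.aeval_X]

theorem comul_coassoc :
    ((Algebra.TensorProduct.assoc ℚ ℚ ℚ Plin Plin Plin).toAlgHom.comp
      (Algebra.TensorProduct.map comul (AlgHom.id ℚ Plin))).comp comul =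
    (Algebra.TensorProduct.map (AlgHom.id ℚ Plin) comul).comp comul := by
  refine MvPolynomial.algHom_ext fun ω => ?_
  simp only [AlgHom.comp_apply, comul_X, map_sum, Algebra.TensorProduct.map_tmul, comul_mat,
    AlgHom.id_apply]
  have : ∀ v ∈ below ω.toList, mat v ω.toList ⊗ₜ[ℚ] comul (gen v) =
      ∑ u ∈ below ω.toList, mat v ω.toList ⊗ₜ[ℚ] (mat u v ⊗ₜ[ℚ] gen u) := fun v hv => by
    rw [comul_gen fun u hu => mem_below_of_mat hu (mem_below.1 hv), TensorProduct.tmul_sum]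
  rw [Finset.sum_congr rfl this, Finset.sum_comm]
  refine Finset.sum_congr rfl fun u _ => ?_
  rw [TensorProduct.sum_tmul, map_sum]
  rfl

/-! ## The counit -/

theorem eval_gen (F : NCSeries₀) (w : List ℕ+) : eval F (gen w) = F.1 w := by
  rcases eq_or_ne w [] with rfl | h
  · rw [gen_nil, map_zero, F.2]
  · rw [gen, dif_pos h, eval, MvPolynomial.aeval_X]

theorem eval_dil (F : NCSeries₀) (k : ℕ+) (w : List ℕ+) :
    eval F (dil k w) = NCSeries.dilate k F.1 w := by
  rw [NCSeries.dilate]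
  by_cases h : ∃ v : List ℕ+, v.map (fun i => k * i) = w
  · obtain ⟨v, rfl⟩ := h
    rw [dil_map, eval_gen, finsum_eq_single _ v fun u hu => by
      rw [finsum_eq_if, if_neg fun h => hu (map_mul_injective k h)]]
    rw [finsum_eq_if, if_pos rfl]
  · rw [dil_eq_zero h, map_zero]
    refine (finsum_eq_zero_of_forall_eq_zero fun v => ?_).symm
    rw [finsum_eq_if, if_neg fun hv => h ⟨v, hv⟩]

/-- This ties the formal matrix to actual series, and is what makes `comul` dual to plethysm. -/
theorem eval_mat (F : NCSeries₀) (u w : List ℕ+) :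
    eval F (mat u w) = (u.map fun k => NCSeries.dilate k F.1).prod w := by
  induction u generalizing w with
  | nil =>
    change _ = (if w = [] then (1 : ℚ) else 0)
    by_cases h : w = [] <;> simp [mat, h]
  | cons k u ih =>
    change _ = ∑ i ∈ Finset.range (w.length + 1), NCSeries.dilate k F.1 (w.take i) *
      (u.map fun k => NCSeries.dilate k F.1).prod (w.drop i)
    simp only [mat, map_sum, map_mul, sum_splits, eval_dil, ih]

theorem counit_gen (w : List ℕ+) : counit (gen w) = if w = [1] then 1 else 0 := eval_gen _ w

theorem counit_dil (k : ℕ+) (w : List ℕ+) : counit (dil k w) = if w = [k] then 1 else 0 := by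
  by_cases h : ∃ v : List ℕ+, v.map (fun i => k * i) = w
  · obtain ⟨v, rfl⟩ := h
    rw [dil_map, counit_gen]
    have : (v.map (fun i => k * i) = [k]) ↔ v = [1] := by
      rw [← (map_mul_injective k).eq_iff (b := [1])]
      simp
    simp only [this]
  · rw [dil_eq_zero h, map_zero, if_neg]
    rintro rfl
    exact h ⟨[1], by simp⟩

/-- At F = x₁ the dilate F_k is the single variable x_k, so the product over u is the monomial x_u.
-/
theorem counit_mat (u w : List ℕ+) : counit (mat u w) = if u = w then 1 else 0 := by
  induction u generalizing w with
  | nil => by_cases h : w = [] <;> simp [mat, h, eq_comm]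
  | cons k u ih =>
    simp only [mat, map_sum, map_mul, counit_dil, ih]
    split_ifs with h
    · rw [Finset.sum_eq_single ([k], u)]
      · simp
      · rintro ⟨p, q⟩ _ hne
        by_contra h0
        apply hne
        simp at h0
        rw [h0.1, h0.2]
      · intro h'
        exact absurd ((mem_splits (p := ([k], u))).2 h) h'
    · refine Finset.sum_eq_zero fun p hp => ?_
      by_contra h0
      simp at h0
      apply h
      rw [← mem_splits.1 hp, h0.2, h0.1]
      rfl

theorem counit_left : ((Algebra.TensorProduct.lid ℚ Plin).toAlgHom.comp
    (Algebra.TensorProduct.map counit (AlgHom.id ℚ Plin))).comp comul = AlgHom.id ℚ Plin := by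
  refine MvPolynomial.algHom_ext fun ω => ?_
  simp only [AlgHom.comp_apply, comul_X, map_sum, Algebra.TensorProduct.map_tmul, counit_mat,
    AlgHom.id_apply]
  rw [Finset.sum_eq_single_of_mem _ (mem_below.2 (Dom.refl _)) fun u _ hu => by simp [hu]]
  simp [gen_toList]

theorem counit_right : ((Algebra.TensorProduct.rid ℚ ℚ Plin).toAlgHom.comp
    (Algebra.TensorProduct.map (AlgHom.id ℚ Plin) counit)).comp comul = AlgHom.id ℚ Plin := by
  refine MvPolynomial.algHom_ext fun ω => ?_
  -- The only surviving term is u = [1], where the matrix entry is the coefficient in F₁ = F.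
  -- Adjoining [1] to the index set avoids checking that it is dominated.
  rw [AlgHom.comp_apply, ← gen_toList, comul_gen (T := insert [1] (below ω.toList))
    fun u hu => Finset.mem_insert_of_mem (mem_below_of_mat hu (Dom.refl _))]
  simp only [AlgHom.comp_apply, map_sum, Algebra.TensorProduct.map_tmul, counit_gen,
    AlgHom.id_apply]
  rw [Finset.sum_eq_single_of_mem [1] (Finset.mem_insert_self ..) fun u _ hu => by simp [hu]]
  simp [mat_singleton, dil_one]

theorem isBialgebra : IsBialgebra Plin comul.toLinearMap counit.toLinearMap where
  coassoc := LinearMap.ext fun a => DFunLike.congr_fun comul_coassoc a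
  counit_left := fun a => DFunLike.congr_fun counit_left a
  counit_right := fun a => DFunLike.congr_fun counit_right a
  comul_one := map_one comul
  comul_mul := map_mul comul
  counit_one := map_one counit
  counit_mul := map_mul counit

/-! ## Duality with plethystic substitution -/

theorem isPlethysticComul_comul : IsPlethysticComul comul := by
  intro ω F G
  rw [comul_X, map_sum, NCSeries.pleth, NCSeries.subst, finsum_eq_sum_of_support_subset
    (s := below ω.toList)]
  · refine Finset.sum_congr rfl fun u _ => ?_
    rw [← eval_mat, ← eval_gen, mul_comm]
    simp [eval₂]
  · intro u hu
    rw [Function.mem_support, ← eval_mat] at hu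
    have : mat u ω.toList ≠ 0 := fun h => right_ne_zero_of_mul hu (by rw [h, map_zero])
    exact mem_below_of_mat this (Dom.refl _)

/-- The tensor square is a polynomial algebra on two copies of W, and every assignment of rational
values to its variables comes from a pair of series. Over the infinite field ℚ, polynomials with
equal values are equal. -/
theorem eval₂_injective {z z' : Plin ⊗[ℚ] Plin} (h : ∀ F G, eval₂ F G z = eval₂ F G z') :
    z = z' := by
  let ser (v : W → ℚ) : NCSeries₀ :=
    ⟨fun w => if h : w ≠ [] then v ⟨w, h⟩ else 0, dif_neg (by simp)⟩
  have hser : ∀ v ω, (ser v).1 (Mr.toList ω) = v ω := fun v ω => dif_pos ω.ne_nil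
  let E : Plin ⊗[ℚ] Plin ≃ₐ[ℚ] MvPolynomial (W ⊕ W) ℚ := MvPolynomial.tensorEquivSum ℚ W W ℚ
  have key : ∀ v : W ⊕ W → ℚ, eval₂ (ser fun ω => v (.inl ω)) (ser fun ω => v (.inr ω)) =
      (MvPolynomial.aeval v).comp E.toAlgHom := fun v => by
    refine Algebra.TensorProduct.ext (MvPolynomial.algHom_ext fun ω => ?_)
      (MvPolynomial.algHom_ext fun ω => ?_)
    · simp [eval₂, eval, E, hser]
    · simp [eval₂, eval, E, hser]
  refine E.injective (MvPolynomial.funext fun v => ?_)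
  have := h (ser fun ω => v (.inl ω)) (ser fun ω => v (.inr ω))
  rw [key] at this
  exact this

theorem IsPlethysticComul.unique {Δ Δ' : Plin →ₐ[ℚ] Plin ⊗[ℚ] Plin} (h : IsPlethysticComul Δ)
    (h' : IsPlethysticComul Δ') : Δ' = Δ :=
  MvPolynomial.algHom_ext fun ω => eval₂_injective fun F G => (h' ω F G).trans (h ω F G).symm

end Plin

/-! ## Homotopy cardinality of discrete groupoids -/

section Thin

variable {A B I : Type} [Category.{0} A] [Groupoid.{0} B]

theorem cls_eq_cls {x y : A} : cls x = cls y ↔ Nonempty (x ≅ y) :=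
  ⟨fun h => Quotient.exact (s := isIsomorphicSetoid A) h,
    fun h => Quotient.sound (s := isIsomorphicSetoid A) h⟩

theorem cls_rep (c : π₀ A) : cls (rep c) = c := Quotient.out_eq (s := isIsomorphicSetoid A) c

/-- The objects `Φ i` represent the isomorphism classes of a category equivalent to a set. -/
structure IsDiscreteOn (Φ : I → A) : Prop where
  thin : ∀ x y : A, Subsingleton (x ⟶ y)
  existsUnique : ∀ a, ∃! i, Nonempty (a ≅ Φ i)

theorem subsingleton_aut (h : ∀ x y : A, Subsingleton (x ⟶ y)) (x : A) : Subsingleton (Aut x) :=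
  ⟨fun a b => Iso.ext ((h x x).elim a.hom b.hom)⟩

theorem IsDiscreteOn.bijective {Φ : I → A} (h : IsDiscreteOn Φ) :
    Function.Bijective fun i => cls (Φ i) := by
  constructor
  · intro i j hij
    exact (h.existsUnique (Φ i)).unique ⟨Iso.refl _⟩ (cls_eq_cls.1 hij)
  · rintro ⟨a⟩
    obtain ⟨i, hi, _⟩ := h.existsUnique a
    exact ⟨i, (cls_eq_cls.2 hi).symm⟩

theorem IsDiscreteOn.finiteGpd [Finite I] {Φ : I → A} (h : IsDiscreteOn Φ) : FiniteGpd A := by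
  refine ⟨Finite.of_surjective _ h.bijective.2, fun x => ?_⟩
  have := subsingleton_aut h.thin x
  infer_instance

theorem IsDiscreteOn.card_eq [Finite I] {Φ : I → A} (h : IsDiscreteOn Φ) :
    card A = Nat.card I := by
  have hf := h.finiteGpd.1
  have : ∀ c : π₀ A, (Nat.card (Aut (rep c)) : ℚ)⁻¹ = 1 := fun c => by
    have := subsingleton_aut h.thin (rep c)
    rw [Nat.card_of_subsingleton (1 : Aut (rep c))]
    simp
  rw [card, finsum_congr this, Nat.card_eq_of_bijective _ h.bijective]
  have := Fintype.ofFinite (π₀ A)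
  rw [finsum_eq_sum_of_fintype]
  simp

/-- Once the source is replaced by a set, a point of the homotopy fibre is an index together with an
isomorphism to b, and nothing is left to identify two such points. -/
theorem IsDiscreteOn.hFibre {Φ : I → A} (h : IsDiscreteOn Φ) (p : A ⥤ B) (b : B) :
    IsDiscreteOn fun x : (i : I) × (p.obj (Φ i) ⟶ b) => (CostructuredArrow.mk x.2 : HFibre p b) where
  thin x y := ⟨fun f g => CostructuredArrow.hom_ext f g ((h.thin x.left y.left).elim f.left g.left)⟩
  existsUnique a := by
    obtain ⟨i, ⟨φ⟩, hi⟩ := h.existsUnique a.left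
    refine ⟨⟨i, p.map φ.inv ≫ a.hom⟩, ⟨CostructuredArrow.isoMk φ (by simp [← p.map_comp_assoc])⟩, ?_⟩
    rintro ⟨j, u⟩ ⟨ψ⟩
    let ψ' : a.left ≅ Φ j := (CostructuredArrow.proj p b).mapIso ψ
    obtain rfl := hi j ⟨ψ'⟩
    have e : ψ.inv.left = φ.inv := (h.thin _ _).elim _ _
    have := CostructuredArrow.w ψ.inv
    rw [e] at this
    exact congrArg _ this.symm

theorem card_hom_of_cls_eq {x y : B} (h : cls x = cls y) : Nat.card (x ⟶ y) = Nat.card (Aut y) := by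
  obtain ⟨φ⟩ := cls_eq_cls.1 h
  exact Nat.card_congr
    { toFun := fun u => asIso (φ.inv ≫ u)
      invFun := fun u => φ.hom ≫ u.hom
      left_inv := fun u => by simp
      right_inv := fun u => by ext; simp }

theorem card_hom_of_cls_ne {x y : B} (h : cls x ≠ cls y) : Nat.card (x ⟶ y) = 0 := by
  have : IsEmpty (x ⟶ y) := ⟨fun u => h (cls_eq_cls.2 ⟨asIso u⟩)⟩
  exact Nat.card_of_isEmpty

/-- Each index i contributes |Hom(p Φᵢ, b)| to the cardinality of the fibre over b. When nonempty,
this Hom set is a torsor under Aut b, so dividing by |Aut b| leaves exactly 1. -/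
theorem IsDiscreteOn.cardMap_eq [Fintype I] {Φ : I → A} (h : IsDiscreteOn Φ) (p : A ⥤ B)
    (hB : ∀ b : B, Finite (Aut b)) : cardMap p = ∑ i, δ (cls (p.obj (Φ i))) := by
  classical
  have hom_finite : ∀ x y : B, Finite (x ⟶ y) := fun x y => by
    by_cases hxy : cls x = cls y
    · have := hB y
      have : Nat.card (x ⟶ y) ≠ 0 := by
        rw [card_hom_of_cls_eq hxy]
        exact Nat.card_pos.ne'
      exact (Nat.card_ne_zero.1 this).2
    · exact @Finite.of_subsingleton _ ⟨fun u => absurd (cls_eq_cls.2 ⟨asIso u⟩) hxy⟩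
  have key : ∀ c : π₀ B, (card (HFibre p (rep c)) / Nat.card (Aut (rep c))) • δ c =
      ∑ i, if cls (p.obj (Φ i)) = c then δ c else 0 := fun c => by
    have := hB (rep c)
    have h0 : (Nat.card (Aut (rep c)) : ℚ) ≠ 0 := by exact_mod_cast Nat.card_pos.ne'
    rw [(h.hFibre p (rep c)).card_eq, Nat.card_sigma, Nat.cast_sum, Finset.sum_div,
      Finset.sum_smul]
    refine Finset.sum_congr rfl fun i _ => ?_
    split_ifs with hc
    · rw [card_hom_of_cls_eq (hc.trans (cls_rep c).symm), div_self h0, one_smul]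
    · rw [card_hom_of_cls_ne fun h => hc (h.trans (cls_rep c))]
      simp
  rw [cardMap, finsum_congr key, finsum_eq_sum_of_support_subset
    (s := Finset.univ.image fun i => cls (p.obj (Φ i)))]
  · rw [Finset.sum_comm]
    refine Finset.sum_congr rfl fun i _ => ?_
    rw [Finset.sum_ite_eq, if_pos (Finset.mem_image_of_mem _ (Finset.mem_univ i))]
  · intro c hc
    obtain ⟨i, _, hi⟩ := Finset.exists_ne_zero_of_sum_ne_zero (Function.mem_support.1 hc)
    simp only [ne_eq, ite_eq_right_iff, Classical.not_imp] at hi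
    simp [← hi.1]

theorem lift_δ {M : Type} [AddCommGroup M] [Module ℚ M] (v : π₀ A → M) (c : π₀ A) :
    lift v (δ c) = v c := by
  simp [lift, δ]

theorem toTensor_δ {A B : Type} [Category.{0} A] [Category.{0} B] (a : A) (b : B) :
    toTensor A B (δ (cls (a, b))) = δ (cls a) ⊗ₜ δ (cls b) := by
  obtain ⟨φ⟩ := cls_eq_cls.1 (cls_rep (cls (a, b)))
  have ha : cls (rep (cls (a, b))).1 = cls a :=
    cls_eq_cls.2 ⟨(CategoryTheory.Prod.fst A B).mapIso φ⟩
  have hb : cls (rep (cls (a, b))).2 = cls b :=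
    cls_eq_cls.2 ⟨(CategoryTheory.Prod.snd A B).mapIso φ⟩
  rw [toTensor, lift_δ, ha, hb]

theorem hom_ext_δ {M : Type} [AddCommGroup M] [Module ℚ M] {f g : Vec A →ₗ[ℚ] M}
    (h : ∀ c : π₀ A, f (δ c) = g (δ c)) : f = g :=
  AddMonoidAlgebra.lhom_ext' fun c => LinearMap.ext_ring (h c)

end Thin

/-! ## Homotopy fibres of maps of free symmetric monoidal groupoids -/

namespace FreeSym

variable {k : ℕ} {X Y : Type}

theorem finite_aut (x : FreeSym k X) : Finite (Aut x) :=
  Finite.of_injective (fun a : Aut x => a.hom.1) fun _ _ h => Iso.ext (Subtype.ext h)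

/-- The sequence of chosen preimages of the entries of a sequence. -/
def preimage (g : X → Y) (f : FreeSym k Y) (x : ∀ i, {a // g a = f.val i}) : FreeSym k X :=
  ⟨f.len, f.le_len, fun i => (x i).1⟩

/-- A choice of preimages as an object of the homotopy pullback. -/
def fibrePoint (g : X → Y) (f : FreeSym k Y) (x : ∀ i, {a // g a = f.val i}) :
    Comma (SimplicialGpd.name f) (map (k := k) g) :=
  ⟨⟨⟨⟩⟩, preimage g f x, ⟨Equiv.refl _, fun i => (x i).2⟩⟩

theorem comma_w {g : X → Y} {f : FreeSym k Y} {a b : Comma (SimplicialGpd.name f) (map (k := k) g)}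
    (h : a ⟶ b) (i : Fin f.len) : h.right.1 (a.hom.1 i) = b.hom.1 i := by
  have := congrArg (fun e => e.1 i) h.w
  exact this.symm

/-- An object carries a bijection from the positions of f to those of a lift. This fixes every
morphism on positions, and relabelling along it gives a unique lift whose bijection is the identity,
that is, a choice of preimages. -/
theorem isDiscreteOn_fibrePoint (g : X → Y) (f : FreeSym k Y) :
    IsDiscreteOn (fibrePoint g f) where
  thin a b := ⟨fun u v => by
    refine Comma.hom_ext _ _ (Subsingleton.elim _ _) (Subtype.ext (Equiv.ext fun i => ?_))
    obtain ⟨j, rfl⟩ := a.hom.1.surjective i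
    rw [comma_w, comma_w]⟩
  existsUnique a := by
    refine ⟨fun i => ⟨a.right.val (a.hom.1 i), a.hom.2 i⟩, ⟨?_⟩, ?_⟩
    · refine Comma.isoMk (Discrete.eqToIso (Subsingleton.elim _ _)) (asIso ⟨a.hom.1.symm, fun i => ?_⟩) ?_
      · exact congrArg a.right.val (a.hom.1.apply_symm_apply i)
      · refine Subtype.ext (Equiv.ext fun i => ?_)
        exact (a.hom.1.symm_apply_apply i).symm
    · rintro x ⟨φ⟩
      funext i
      refine Subtype.ext ?_
      have h := φ.hom.right.2 (a.hom.1 i)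
      rw [comma_w φ.hom] at h
      exact h

/-- The same rigidity with the comparison isomorphism reversed, as local finiteness is phrased with
`HFibre` rather than with the homotopy pullback along a point. Every object is isomorphic to one of
finitely many choices of preimages. -/
theorem finiteGpd_hFibre (g : X → Y) (hg : ∀ y, Finite {a // g a = y}) (f : FreeSym k Y) :
    FiniteGpd (HFibre (map (k := k) g) f) := by
  have w : ∀ {a b : HFibre (map (k := k) g) f} (h : a ⟶ b) i, b.hom.1 (h.left.1 i) = a.hom.1 i :=
    fun {a b} h i => congrArg (fun e => e.1 i) (CostructuredArrow.w h)
  have thin : ∀ a b : HFibre (map (k := k) g) f, Subsingleton (a ⟶ b) := fun a b => ⟨fun u v => by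
    refine CostructuredArrow.hom_ext _ _ (Subtype.ext (Equiv.ext fun i => b.hom.1.injective ?_))
    rw [w, w]⟩
  constructor
  · refine Finite.of_surjective (fun x : ∀ i, {a // g a = f.val i} =>
      cls (CostructuredArrow.mk (⟨Equiv.refl _, fun i => (x i).2.symm⟩ :
        (map (k := k) g).obj (preimage g f x) ⟶ f) : HFibre (map (k := k) g) f)) ?_
    rintro ⟨a⟩
    have e : ∀ i, g (a.left.val (a.hom.1.symm i)) = f.val i := fun i =>
      (a.hom.2 _).symm.trans (congrArg f.val (a.hom.1.apply_symm_apply i))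
    refine ⟨fun i => ⟨a.left.val (a.hom.1.symm i), e i⟩, cls_eq_cls.2 ⟨CostructuredArrow.isoMk
      (asIso ⟨a.hom.1.symm, fun i => rfl⟩) ?_⟩⟩
    refine Subtype.ext (Equiv.ext fun i => ?_)
    exact a.hom.1.apply_symm_apply i
  · intro a
    have := subsingleton_aut thin a
    infer_instance

end FreeSym

theorem finite_aut_prod {A B : Type} [Category.{0} A] [Category.{0} B] (hA : ∀ a : A, Finite (Aut a))
    (hB : ∀ b : B, Finite (Aut b)) (x : A × B) : Finite (Aut x) := by
  have := hA x.1
  have := hB x.2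
  let φ (a : Aut x) : Aut x.1 × Aut x.2 :=
    ((CategoryTheory.Prod.fst A B).mapIso a, (CategoryTheory.Prod.snd A B).mapIso a)
  exact Finite.of_injective φ fun a b h => Iso.ext (Prod.ext
    (congrArg (fun p => p.1.hom) h) (congrArg (fun p => p.2.hom) h))

/-! ## Incidence coalgebras of bar constructions -/

namespace MrOperad

variable (Q : MrOperad) (k : ℕ)

/-- Composition of two-level trees. -/
def treeComp : (Q.tree 2).E → (Q.tree 1).E := Q.monMulFun (Q.tree 0)

/-- The root of a two-level tree. -/
def treeRoot : (Q.tree 2).E → (Q.tree 1).E := (Q.treeFace 1 0).1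

/-- The branches of a two-level tree. -/
def treeBranches (p : (Q.tree 2).E) : Mr (Q.tree 1).E := p.1.1

/-- The trivial one-level trees. -/
def treeUnit : (Q.tree 0).E → (Q.tree 1).E := (Q.treeDegen 0 0).1

theorem bar_locallyFinite (h : ∀ x, Finite {a // Q.treeComp a = x})
    (h' : ∀ x, Finite {a // Q.treeUnit a = x}) : (Q.bar k).LocallyFinite :=
  ⟨FreeSym.finite_aut, FreeSym.finiteGpd_hFibre Q.treeUnit h',
    FreeSym.finiteGpd_hFibre Q.treeComp h⟩

/-- The homotopy pullback along d₁ is the set of ways to write each entry as a composite. Deleting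
roots gives the left factor and keeping only roots the right factor. -/
theorem bar_comul (h : ∀ x, Fintype {a // Q.treeComp a = x})
    (c : π₀ (FreeSym k (Q.tree 1).E)) :
    (Q.bar k).comul (δ c) = ∑ x : (∀ i, {a // Q.treeComp a = (rep c).val i}),
      δ (cls (G := (Q.bar k).obj 1) ((FreeSym.bind Q.treeBranches).obj (FreeSym.preimage _ (rep c) x))) ⊗ₜ
        δ (cls (G := (Q.bar k).obj 1) ((FreeSym.map Q.treeRoot).obj (FreeSym.preimage _ (rep c) x))) := by
  refine (lift_δ (A := (Q.bar k).obj 1) _ c).trans ?_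
  have := (FreeSym.isDiscreteOn_fibrePoint (k := k) Q.treeComp (rep c)).cardMap_eq
    ((Q.bar k).comulFunctor (SimplicialGpd.name (rep c)))
    (finite_aut_prod FreeSym.finite_aut FreeSym.finite_aut)
  exact (congrArg _ this).trans ((map_sum ..).trans
    (Finset.sum_congr rfl fun x _ => toTensor_δ _ _))

theorem bar_counit (h : ∀ x, Finite {a // Q.treeUnit a = x})
    (c : π₀ (FreeSym k (Q.tree 1).E)) :
    (Q.bar k).counit (δ c) = Nat.card (∀ i, {a // Q.treeUnit a = (rep c).val i}) := by
  refine (lift_δ (A := (Q.bar k).obj 1) _ c).trans ?_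
  exact (FreeSym.isDiscreteOn_fibrePoint (k := k) Q.treeUnit (rep c)).card_eq

end MrOperad

/-! ## Factorizations of words -/

/-- Multiplication of the letters of a word by a positive integer. -/
def scale (q : ℕ+ × W) : List ℕ+ := q.2.toList.map fun i => q.1 * i

/-- Each block is a nonempty word of multiples of its factor. This bounds the sequences of factors
of a given word, so its factorizations form a finite set. -/
theorem dom_flatMap_scale (L : List (ℕ+ × W)) : Dom (L.map Prod.fst) (L.flatMap scale) := by
  induction L with
  | nil => exact Dom.refl _
  | cons q L ih =>
    refine Dom.append (u := [q.1]) ?_ ih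
    obtain ⟨k, l, hl⟩ := q
    obtain ⟨a, l, rfl⟩ := List.exists_cons_of_ne_nil hl
    refine ⟨by simp [scale], fun x hx => ⟨k * a, by simp [scale], ?_⟩⟩
    rw [List.mem_singleton.1 hx]
    exact le_mul_of_one_le_right' one_le

open Classical in
/-- The quotient of a word by a positive integer, if it exists. -/
noncomputable def quot (k : ℕ+) (v : List ℕ+) : Finset W :=
  if h : ∃ y : W, scale (k, y) = v then {h.choose} else ∅

theorem mem_quot {k : ℕ+} {v : List ℕ+} {y : W} : y ∈ quot k v ↔ scale (k, y) = v := by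
  rw [quot]
  split_ifs with h
  · rw [Finset.mem_singleton]
    constructor
    · rintro rfl
      exact h.choose_spec
    · intro hy
      exact Mr.ext (map_mul_injective k (hy.trans h.choose_spec.symm))
  · simp only [Finset.notMem_empty, false_iff]
    exact fun hy => h ⟨y, hy⟩

open Classical in
/-- The factorizations of a word `w` as a concatenation of multiples of words, with given sequence
of factors. -/
noncomputable def factsOver : List ℕ+ → List ℕ+ → Finset (List (ℕ+ × W))
  | [], w => if w = [] then {[]} else ∅
  | k :: u, w => (splits w).biUnion fun p =>
      (quot k p.1 ×ˢ factsOver u p.2).image fun q => (k, q.1) :: q.2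

theorem mem_factsOver {u w : List ℕ+} {L : List (ℕ+ × W)} :
    L ∈ factsOver u w ↔ L.map Prod.fst = u ∧ L.flatMap scale = w := by
  induction u generalizing w L with
  | nil =>
    rw [factsOver]
    split_ifs with h
    · subst h
      simp only [Finset.mem_singleton, List.map_eq_nil_iff]
      exact ⟨fun h => by simp [h], fun h => h.1⟩
    · simp only [Finset.notMem_empty, false_iff, List.map_eq_nil_iff]
      rintro ⟨rfl, rfl⟩
      exact h rfl
  | cons k u ih =>
    simp only [factsOver, Finset.mem_biUnion, Finset.mem_image, Finset.mem_product, mem_quot, ih,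
      mem_splits]
    constructor
    · rintro ⟨p, hp, q, ⟨h₁, h₂, h₃⟩, rfl⟩
      refine ⟨by rw [List.map_cons, h₂], ?_⟩
      rw [List.flatMap_cons, h₁, h₃, hp]
    · rintro ⟨h₁, h₂⟩
      cases L with
      | nil => simp at h₁
      | cons q L =>
        rw [List.map_cons, List.cons.injEq] at h₁
        obtain ⟨rfl, h₁⟩ := h₁
        exact ⟨(scale q, L.flatMap scale), h₂, (q.2, L), ⟨rfl, h₁, rfl⟩, rfl⟩

/-! ### Monomial expansion of the matrix entries -/

namespace Plin

theorem dil_eq_sum (k : ℕ+) (v : List ℕ+) :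
    dil k v = ∑ y ∈ quot k v, MvPolynomial.X y := by
  by_cases h : ∃ y : W, scale (k, y) = v
  · obtain ⟨y, rfl⟩ := h
    have : quot k (scale (k, y)) = {y} := by
      ext z
      rw [mem_quot, Finset.mem_singleton]
      exact ⟨fun h => Mr.ext (map_mul_injective k h), fun h => by rw [h]⟩
    rw [this, Finset.sum_singleton, scale, dil_map, gen_toList]
  · rw [Finset.sum_eq_zero fun y hy => absurd ⟨y, mem_quot.1 hy⟩ h]
    by_contra hne
    obtain ⟨u, hu, hv⟩ := exists_of_dil_ne_zero hne
    exact h ⟨⟨u, hu⟩, hv⟩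

/-- Multiplying out F_{u₁}⋯F_{uₙ} picks one monomial in each factor; distinct choices are distinct
factorizations, so each appears once. -/
theorem mat_eq_sum (u w : List ℕ+) :
    mat u w = ∑ L ∈ factsOver u w, (L.map fun q => (MvPolynomial.X q.2 : Plin)).prod := by
  classical
  induction u generalizing w with
  | nil =>
    rw [mat, factsOver]
    split_ifs <;> simp
  | cons k u ih =>
    rw [mat, factsOver, Finset.sum_biUnion]
    · refine Finset.sum_congr rfl fun p _ => ?_
      rw [Finset.sum_image, dil_eq_sum, ih, Finset.sum_mul_sum, ← Finset.sum_product']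
      · simp
      · rintro ⟨y, L⟩ _ ⟨y', L'⟩ _ h
        simpa using h
    · intro p hp p' hp' hne
      refine Finset.disjoint_left.2 fun L hL hL' => hne ?_
      simp only [Finset.mem_image, Finset.mem_product, mem_quot, mem_factsOver] at hL hL'
      obtain ⟨q, ⟨h₁, _, h₂⟩, rfl⟩ := hL
      obtain ⟨q', ⟨h₁', _, h₂'⟩, h⟩ := hL'
      simp only [List.cons.injEq, Prod.mk.injEq, true_and] at h
      exact Prod.ext (by rw [← h₁, ← h₁', h.1]) (by rw [← h₂, ← h₂', h.2])

end Plin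

open Classical in
/-- The factorizations of a word as a concatenation of multiples of words. -/
noncomputable def facts (w : List ℕ+) : Finset (List (ℕ+ × W)) :=
  (below w).biUnion fun u => factsOver u w

theorem mem_facts {w : List ℕ+} {L : List (ℕ+ × W)} : L ∈ facts w ↔ L.flatMap scale = w := by
  simp only [facts, Finset.mem_biUnion, mem_factsOver, mem_below]
  constructor
  · rintro ⟨_, _, _, h⟩
    exact h
  · rintro rfl
    exact ⟨_, dom_flatMap_scale L, rfl, rfl⟩

theorem Plin.comul_X_eq_sum_facts (ω : W) : comul (MvPolynomial.X ω) =
    ∑ L ∈ facts ω.toList,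
      (L.map fun q => (MvPolynomial.X q.2 : Plin)).prod ⊗ₜ gen (L.map Prod.fst) := by
  classical
  rw [comul_X, facts, Finset.sum_biUnion]
  · refine Finset.sum_congr rfl fun u _ => ?_
    rw [mat_eq_sum, TensorProduct.sum_tmul]
    exact Finset.sum_congr rfl fun L hL => by rw [(mem_factsOver.1 hL).1]
  · intro u _ u' _ hne
    refine Finset.disjoint_left.2 fun L hL hL' => hne ?_
    rw [← (mem_factsOver.1 hL).1, ← (mem_factsOver.1 hL').1]

/-! ## Trees of operations of `Ass.T` -/

namespace Ass

/-- The arity of an arrow. -/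
def size (f : Ass.Arr) : ℕ+ := ⟨f.op.toList.length, List.length_pos_iff.2 f.op.ne_nil⟩

theorem D_unit_left (u : Mr Unit) : Mr.D ((), u) = u := by
  rw [Mr.D_eq]
  exact Mr.map_id' u

theorem base_eq (f : Ass.Arr) : f.base.2 = f.op := (D_unit_left f.base.2).symm.trans f.eq

theorem length_mul_D (u v : Mr Unit) :
    (Mr.mul (Mr.D (u, v))).toList.length = v.toList.length * u.toList.length := by
  rw [Mr.D_eq]
  simp [Mr.mul, Mr.map, List.length_flatMap]

/-- Composing plugs a copy of f into each input of g, so arities multiply. This is the source of the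
multiplication of indices in F_k. -/
theorem size_comp' (f g : Ass.Arr) : size (Ass.toCat.comp' f g) = size g * size f := by
  rw [Ass.toCat.comp'_eq (show Ass.toCat.tgt f = Ass.toCat.src g from rfl)]
  refine PNat.eq ((length_mul_D f.op g.base.2).trans ?_)
  rw [base_eq]
  rfl

theorem size_bijective : Function.Bijective size := by
  constructor
  · rintro f g hs
    have h : f.op = g.op := Mr.ext (List.ext_getElem (congrArg PNat.val hs) fun _ _ _ => rfl)
    exact MrOperad.Arr.ext (Prod.ext rfl ((base_eq f).trans (h.trans (base_eq g).symm))) h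
  · intro n
    refine ⟨⟨((), ⟨List.replicate n (), by simp⟩), ⟨List.replicate n (), by simp⟩, D_unit_left _⟩,
      PNat.eq (List.length_replicate ..)⟩

/-- The word of an operation. -/
def opWord (x : Ass.toCat.Op) : W := x.arr.map size

/-- The word of a one-level tree. -/
def word (p : (Ass.T.tree 1).E) : W := opWord p.1.2

theorem opWord_injective : Function.Injective opWord := fun _ _ h =>
  IntCat.Op.ext' (List.map_injective_iff.2 size_bijective.1 (congrArg Mr.toList h)) rfl

theorem opWord_surjective : Function.Surjective opWord := fun ω => by
  refine ⟨⟨ω.map (Function.surjInv size_bijective.2), ((), ω.map fun _ => ()), ?_⟩, ?_⟩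
  · exact (Mr.map_map ..).trans (D_unit_left _).symm
  · refine (Mr.map_map ..).trans (Eq.trans ?_ (Mr.map_id' ω))
    exact congrArg (fun g => Mr.map g ω) (funext fun n => Function.surjInv_eq size_bijective.2 n)

/-- The leaves of a one-level tree carry only the input colours, which its operation determines. -/
theorem word_bijective : Function.Bijective word := by
  constructor
  · intro p q h
    have h₂ : p.1.2 = q.1.2 := opWord_injective h
    refine Subtype.ext (Prod.ext ?_ h₂)
    have hp : p.1.1 = Ass.T.s p.1.2 := (Mr.map_id' _).symm.trans p.2
    have hq : q.1.1 = Ass.T.s q.1.2 := (Mr.map_id' _).symm.trans q.2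
    rw [hp, hq, h₂]
  · intro ω
    obtain ⟨x, rfl⟩ := opWord_surjective ω
    exact ⟨⟨(Ass.T.s x, x), Mr.map_id' _⟩, rfl⟩

/-- The factorization of a word given by a two-level tree. -/
def fact (p : (Ass.T.tree 2).E) : List (ℕ+ × W) :=
  List.zip (opWord p.1.2).toList ((Ass.T.treeBranches p).toList.map word)

theorem length_eq (p : (Ass.T.tree 2).E) :
    (opWord p.1.2).toList.length = ((Ass.T.treeBranches p).toList.map word).length := by
  have := congrArg (fun l => l.toList.length) p.2
  simp only [Mr.map, List.length_map] at this
  rw [List.length_map]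
  refine (List.length_map ..).trans (Eq.trans ?_ this.symm)
  exact (List.length_map ..).symm

theorem map_fst_fact (p : (Ass.T.tree 2).E) : (fact p).map Prod.fst = (opWord p.1.2).toList :=
  List.map_fst_zip (length_eq p).le

theorem map_snd_fact (p : (Ass.T.tree 2).E) :
    (fact p).map Prod.snd = (Ass.T.treeBranches p).toList.map word :=
  List.map_snd_zip (length_eq p).ge

/-- Stated for arbitrary lists, so that the induction does not involve the matching conditions built
into trees. -/
theorem map_flatten_zipWith {A B C D E F : Type*} (κ : B → A → List C) (r : D → B) (s : C → E)
    (a : A → F) (t : D → W) (g : F × W → List E) (h : ∀ x y, (κ (r y) x).map s = g (a x, t y))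
    (l : List A) (l' : List D) :
    (List.zipWith κ (l'.map r) l).flatten.map s = (List.zip (l.map a) (l'.map t)).flatMap g := by
  induction l generalizing l' with
  | nil => simp
  | cons x l ih =>
    cases l' with
    | nil => simp
    | cons y l' => simp [h, ih]

theorem word_treeComp (p : (Ass.T.tree 2).E) :
    (word (Ass.T.treeComp p)).toList = (fact p).flatMap scale := by
  refine Eq.trans (congrArg (List.map size) (Ass.toCat.opComp_toList _ _ _))
    (map_flatten_zipWith Ass.toCat.K (fun q : (Ass.T.tree 1).E => q.1.2) size size word scale
      (fun f y => ?_) p.1.2.arr.toList p.1.1.toList)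
  refine (List.map_map ..).trans (Eq.trans ?_ (List.map_map ..).symm)
  exact List.map_congr_left fun g _ => size_comp' g f

theorem fact_injective : Function.Injective fact := by
  intro p q h
  have h₁ : opWord p.1.2 = opWord q.1.2 := Mr.ext (by rw [← map_fst_fact, h, map_fst_fact])
  have h₂ := map_snd_fact q
  rw [← h, map_snd_fact] at h₂
  exact Subtype.ext (Prod.ext (Mr.ext (List.map_injective_iff.2 word_bijective.1 h₂))
    (opWord_injective h₁))

/-- The factors form the root and the words form the branches. With a single colour, the matching
condition is only an equality of lengths. -/
theorem exists_fact {L : List (ℕ+ × W)} (hL : L ≠ []) : ∃ p, fact p = L := by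
  obtain ⟨x, hx⟩ := opWord_surjective ⟨L.map Prod.fst, by simpa using hL⟩
  let y : Mr (Ass.T.tree 1).E :=
    ⟨L.map fun q => Function.surjInv word_bijective.2 q.2, by simpa using hL⟩
  refine ⟨⟨(y, x), ?_⟩, ?_⟩
  · refine Mr.ext (List.ext_getElem ?_ fun _ _ _ => rfl)
    have := congrArg (fun l => l.toList.length) hx
    simp only [opWord, Mr.map, List.length_map] at this
    refine (List.length_map ..).trans ((List.length_map ..).trans ?_)
    exact this.symm.trans (List.length_map ..).symm
  · change List.zip (opWord x).toList ((L.map _).map word) = L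
    rw [hx, List.map_map]
    have : (word ∘ fun q : ℕ+ × W => Function.surjInv word_bijective.2 q.2) = Prod.snd :=
      funext fun q => Function.surjInv_eq word_bijective.2 q.2
    rw [this]
    exact (List.zip_of_prod rfl rfl).symm

theorem finite_treeComp (x : (Ass.T.tree 1).E) : Finite {p // Ass.T.treeComp p = x} :=
  Finite.of_injective (fun p => (⟨fact p.1, mem_facts.2 (by rw [← word_treeComp, p.2])⟩ :
    {L // L ∈ facts (word x).toList})) fun _ _ h =>
      Subtype.ext (fact_injective (congrArg Subtype.val h))

theorem finite_treeUnit (x : (Ass.T.tree 1).E) : Finite {a // Ass.T.treeUnit a = x} :=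
  have : Finite (Ass.T.tree 0).E := inferInstanceAs (Finite Unit)
  Subtype.finite

/-- There is one colour, and its unit is the one-letter sequence of the identity arrow, which has
arity 1. -/
theorem card_treeUnit (x : (Ass.T.tree 1).E) :
    Nat.card {a // Ass.T.treeUnit a = x} = if (word x).toList = [1] then 1 else 0 := by
  have h : (word (Ass.T.treeUnit ())).toList = [1] := rfl
  have : Subsingleton {a // Ass.T.treeUnit a = x} := ⟨fun _ _ => Subtype.ext rfl⟩
  split_ifs with hx
  · exact Nat.card_of_subsingleton
      (⟨(), word_bijective.1 (Mr.ext (h.trans hx.symm))⟩ : {a // Ass.T.treeUnit a = x})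
  · have : IsEmpty {a // Ass.T.treeUnit a = x} := ⟨fun a => hx (by rw [← a.2]; exact h)⟩
    exact Nat.card_of_isEmpty

theorem comul_X_word [∀ x, Fintype {p // Ass.T.treeComp p = x}] (x : (Ass.T.tree 1).E) :
    Plin.comul (MvPolynomial.X (word x)) = ∑ p : {p // Ass.T.treeComp p = x},
      ((Ass.T.treeBranches p.1).toList.map fun y => (MvPolynomial.X (word y) : Plin)).prod ⊗ₜ
        MvPolynomial.X (word (Ass.T.treeRoot p.1)) := by
  rw [Plin.comul_X_eq_sum_facts]
  symm
  refine Finset.sum_bij (fun p _ => fact p.1) ?_ ?_ ?_ ?_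
  · intro p _
    rw [mem_facts, ← word_treeComp, p.2]
  · intro p _ q _ h
    exact Subtype.ext (fact_injective h)
  · intro L hL
    rw [mem_facts] at hL
    obtain ⟨p, rfl⟩ := exists_fact (L := L) (by
      rintro rfl
      exact (word x).ne_nil hL.symm)
    exact ⟨⟨p, word_bijective.1 (Mr.ext ((word_treeComp p).trans hL))⟩, Finset.mem_univ _, rfl⟩
  · intro p _
    have h : (fact p.1).map (fun q => (MvPolynomial.X q.2 : Plin)) =
        (Ass.T.treeBranches p.1).toList.map fun y => (MvPolynomial.X (word y) : Plin) := by
      have := congrArg (List.map fun ω => (MvPolynomial.X ω : Plin)) (map_snd_fact p.1)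
      rwa [List.map_map, List.map_map] at this
    rw [h, map_fst_fact, Plin.gen_toList]
    rfl

/-! ### Isomorphism classes of sequences of trees as monomials -/

variable {k : ℕ}

/-- The exponent of the monomial of a sequence of one-level trees. -/
noncomputable def exponent (f : FreeSym k (Ass.T.tree 1).E) : W →₀ ℕ :=
  ∑ i, Finsupp.single (word (f.val i)) 1

theorem exponent_eq {f g : FreeSym k (Ass.T.tree 1).E} (h : cls f = cls g) :
    exponent f = exponent g := by
  obtain ⟨φ⟩ := cls_eq_cls.1 h
  exact Fintype.sum_equiv φ.hom.1 _ _ fun i => by rw [φ.hom.2]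

theorem exponent_apply (f : FreeSym k (Ass.T.tree 1).E) (ω : W) :
    exponent f ω = Nat.card {i // word (f.val i) = ω} := by
  classical
  rw [exponent, Finsupp.finsetSum_apply, Nat.card_eq_fintype_card, Fintype.card_subtype,
    Finset.card_filter]
  exact Finset.sum_congr rfl fun i _ => Finsupp.single_apply

/-- Equal exponents mean that each word occurs equally often; bijections between the sets of
occurrences glue to a permutation of positions. -/
theorem cls_eq_of_exponent {f g : FreeSym k (Ass.T.tree 1).E} (h : exponent f = exponent g) :
    cls f = cls g := by
  have e : ∀ ω, Nonempty ({i // word (f.val i) = ω} ≃ {i // word (g.val i) = ω}) := fun ω =>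
    Finite.card_eq.1 (by rw [← exponent_apply, h, exponent_apply])
  refine FreeSym.cls_eq ((Equiv.sigmaFiberEquiv fun i => word (f.val i)).symm.trans
    ((Equiv.sigmaCongrRight fun ω => (e ω).some).trans
      (Equiv.sigmaFiberEquiv fun i => word (g.val i)))) fun i => word_bijective.1 ?_
  exact ((e (word (f.val i))).some ⟨i, rfl⟩).2

theorem exponent_add (f g : FreeSym k (Ass.T.tree 1).E) :
    exponent (FreeSym.add.obj (f, g)) = exponent f + exponent g := by
  refine (Fin.sum_univ_add (a := f.len) (b := g.len) _).trans ?_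
  simp only [FreeSym.add, Fin.append_left, Fin.append_right]
  rfl

theorem toMultiset_injective : Function.Injective (Finsupp.toMultiset : (W →₀ ℕ) → Multiset W) := by
  classical
  exact Multiset.toFinsupp.symm.injective

theorem exists_exponent (s : W →₀ ℕ) (h : k ≤ s.toMultiset.toList.length) :
    ∃ f : FreeSym k (Ass.T.tree 1).E, exponent f = s := by
  refine ⟨⟨_, h, fun i => Function.surjInv word_bijective.2 (s.toMultiset.toList.get i)⟩, ?_⟩
  simp only [exponent, Function.surjInv_eq]
  refine toMultiset_injective ?_
  rw [map_sum]
  simp only [Finsupp.toMultiset_single, one_smul, List.get_eq_getElem]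
  refine (Fin.sum_univ_fun_getElem _ fun ω : W => ({ω} : Multiset W)).trans ?_
  rw [← Multiset.sum_coe, ← Multiset.map_coe, Multiset.coe_toList, Multiset.sum_map_singleton]

theorem exponent_ne_zero (f : FreeSym 1 (Ass.T.tree 1).E) : exponent f ≠ 0 := by
  intro h
  have := DFunLike.congr_fun h (word (f.val ⟨0, f.le_len⟩))
  rw [exponent_apply, Finsupp.zero_apply, Nat.card_eq_zero] at this
  rcases this with h | h
  · exact h.elim ⟨_, rfl⟩
  · exact h.not_finite inferInstance

/-- The exponent of the monomial of an isomorphism class. -/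
noncomputable def exponentCls (c : π₀ ((Ass.T.bar k).obj 1)) : W →₀ ℕ :=
  Quotient.lift (exponent (k := k)) (fun _ _ h => exponent_eq (cls_eq_cls.2 h)) c

theorem exponentCls_cls (f : FreeSym k (Ass.T.tree 1).E) :
    exponentCls (cls (G := (Ass.T.bar k).obj 1) f) = exponent f := rfl

theorem exponentCls_injective :
    Function.Injective (exponentCls : π₀ ((Ass.T.bar k).obj 1) → W →₀ ℕ) := by
  rintro ⟨f⟩ ⟨g⟩ h
  exact cls_eq_of_exponent h

theorem exponentCls_add (c d : π₀ ((Ass.T.bar k).obj 1)) :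
    exponentCls (c + d) = exponentCls c + exponentCls d := by
  obtain ⟨f⟩ := c
  obtain ⟨g⟩ := d
  exact exponent_add f g

/-- The linear map from the incidence bialgebra to polynomials. -/
noncomputable def toPlin (k : ℕ) : Ass.T.Inc k →ₗ[ℚ] Plin :=
  lift fun c => MvPolynomial.monomial (exponentCls c) 1

theorem toPlin_δ (c : π₀ ((Ass.T.bar k).obj 1)) :
    toPlin k (δ c) = MvPolynomial.monomial (exponentCls c) 1 := lift_δ ..

theorem toPlin_δ_cls (f : FreeSym k (Ass.T.tree 1).E) :
    toPlin k (δ (cls (G := (Ass.T.bar k).obj 1) f)) = ∏ i, MvPolynomial.X (word (f.val i)) := by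
  rw [toPlin_δ, exponentCls_cls, exponent, MvPolynomial.monomial_sum_one]
  rfl

theorem toPlin_δ_rep (c : π₀ (FreeSym k (Ass.T.tree 1).E)) :
    toPlin k (δ c) = ∏ i, MvPolynomial.X (word ((rep c).val i)) := by
  conv_lhs => rw [← cls_rep c]
  exact toPlin_δ_cls _

theorem toPlin_injective : Function.Injective (toPlin k) := by
  have h : Function.Injective (Finsupp.linearCombination ℚ fun c : π₀ ((Ass.T.bar k).obj 1) =>
      (MvPolynomial.monomial (exponentCls c) 1 : Plin)) :=
    (MvPolynomial.basisMonomials W ℚ).linearIndependent.comp _ exponentCls_injective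
  exact h.comp (AddMonoidAlgebra.coeffLinearEquiv ℚ).injective

/-- The monomials of isomorphism classes are multiplicative. -/
noncomputable def monomialHom (k : ℕ) : Multiplicative (π₀ ((Ass.T.bar k).obj 1)) →ₙ* Plin where
  toFun c := MvPolynomial.monomial (exponentCls c.toAdd) 1
  map_mul' c d := by
    rw [toAdd_mul, exponentCls_add, MvPolynomial.monomial_mul, one_mul]

/-- `toPlin` as a homomorphism of nonunital algebras. -/
noncomputable def toPlinHom (k : ℕ) : Ass.T.Inc k →ₙₐ[ℚ] Plin :=
  AddMonoidAlgebra.liftMagma ℚ (monomialHom k)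

theorem toPlinHom_eq : (toPlinHom k : Ass.T.Inc k →ₗ[ℚ] Plin) = toPlin k := by
  refine hom_ext_δ fun c => ?_
  rw [toPlin_δ]
  change AddMonoidAlgebra.liftMagma ℚ (monomialHom k) (AddMonoidAlgebra.single c 1) = _
  rw [AddMonoidAlgebra.liftMagma_apply_apply]
  simp [monomialHom]

/-- The degree bound is the only obstruction: it is vacuous for k = 0 and excludes exactly the
constant monomial for k = 1. -/
theorem monomial_mem_range {s : W →₀ ℕ} (h : k ≤ s.toMultiset.toList.length) (r : ℚ) :
    MvPolynomial.monomial s r ∈ LinearMap.range (toPlin k) := by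
  obtain ⟨f, rfl⟩ := exists_exponent s h
  refine ⟨r • δ (cls (G := (Ass.T.bar k).obj 1) f), ?_⟩
  rw [map_smul, toPlin_δ, exponentCls_cls, MvPolynomial.smul_monomial, smul_eq_mul, mul_one]

theorem toPlin_surjective : Function.Surjective (toPlin 0) := fun p => by
  rw [← LinearMap.mem_range, p.as_sum]
  exact Submodule.sum_mem _ fun s _ => monomial_mem_range (Nat.zero_le _) _

open Classical in
theorem mem_range_toPlin {p : Plin} :
    p ∈ LinearMap.range (toPlin 1) ↔ MvPolynomial.constantCoeff p = 0 := by
  constructor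
  · rintro ⟨a, rfl⟩
    have : (MvPolynomial.lcoeff ℚ (0 : W →₀ ℕ)).comp (toPlin 1) = 0 := by
      refine hom_ext_δ fun c => ?_
      rw [LinearMap.comp_apply, toPlin_δ]
      obtain ⟨f⟩ := c
      exact (MvPolynomial.coeff_monomial ..).trans (if_neg (exponent_ne_zero f))
    exact DFunLike.congr_fun this a
  · intro h
    rw [p.as_sum]
    refine Submodule.sum_mem _ fun s hs => monomial_mem_range ?_ _
    rw [Multiset.length_toList, Nat.one_le_iff_ne_zero, Ne, Multiset.card_eq_zero,
      ← map_zero Finsupp.toMultiset, toMultiset_injective.eq_iff]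
    rintro rfl
    exact MvPolynomial.mem_support_iff.1 hs h

/-! ### Compatibility with comultiplication and counit -/

theorem prod_tmul_prod {ι A B : Type} [CommRing A] [Algebra ℚ A] [CommRing B] [Algebra ℚ B]
    (s : Finset ι) (a : ι → A) (b : ι → B) :
    (∏ i ∈ s, a i) ⊗ₜ[ℚ] (∏ i ∈ s, b i) = ∏ i ∈ s, a i ⊗ₜ[ℚ] b i := by
  classical
  induction s using Finset.induction_on with
  | empty => rfl
  | insert i s hi ih =>
    rw [Finset.prod_insert hi, Finset.prod_insert hi, Finset.prod_insert hi, ← ih,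
      Algebra.TensorProduct.tmul_mul_tmul]

/-- Positions of a concatenation are pairs of a block and a position in it, so the product is
computed block by block. -/
theorem prod_bind {X Y A : Type} [CommMonoid A] (g : X → Mr Y) (f : FreeSym k X) (a : Y → A) :
    ∏ j, a (((FreeSym.bind g).obj f).val j) = ∏ i, ((g (f.val i)).toList.map a).prod := by
  refine (Fintype.prod_equiv finSigmaFinEquiv.symm _
    (fun p => a (FreeSym.entry g f p)) fun _ => rfl).trans ?_
  rw [Fintype.prod_sigma]
  refine Finset.prod_congr rfl fun i _ => ?_
  rw [← List.prod_ofFn]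
  congr 1
  exact (List.ofFn_getElem_eq_map _ a)

theorem map_toPlin_comul (a : Ass.T.Inc k) :
    TensorProduct.map (toPlin k) (toPlin k) ((Ass.T.bar k).comul a) = Plin.comul (toPlin k a) := by
  classical
  have (x : (Ass.T.tree 1).E) : Fintype {p // Ass.T.treeComp p = x} :=
    @Fintype.ofFinite _ (finite_treeComp x)
  have : (TensorProduct.map (toPlin k) (toPlin k)).comp (Ass.T.bar k).comul =
      Plin.comul.toLinearMap.comp (toPlin k) := by
    refine hom_ext_δ fun c => ?_
    refine (congrArg (TensorProduct.map (toPlin k) (toPlin k)) (Ass.T.bar_comul k this c)).trans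
      (Eq.trans ?_ (congrArg Plin.comul (toPlin_δ_rep c)).symm)
    rw [map_sum, map_prod]
    simp only [TensorProduct.map_tmul, toPlin_δ_cls, comul_X_word]
    -- The product over entries of sums over two-level trees expands into a sum over choices of a
    -- tree for each entry, which is the index set in `bar_comul`.
    rw [Finset.prod_univ_sum, Fintype.piFinset_univ]
    refine Finset.sum_congr rfl fun x _ => ?_
    rw [← prod_tmul_prod]
    congr 1
    exact prod_bind Ass.T.treeBranches (FreeSym.preimage _ (rep c) x)
      fun y => (MvPolynomial.X (word y) : Plin)
  exact DFunLike.congr_fun this a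

theorem counit_toPlin (a : Ass.T.Inc k) :
    Plin.counit (toPlin k a) = (Ass.T.bar k).counit a := by
  have : Plin.counit.toLinearMap.comp (toPlin k) = (Ass.T.bar k).counit := by
    refine hom_ext_δ fun c => ?_
    refine (congrArg Plin.counit (toPlin_δ_rep c)).trans
      (Eq.trans ?_ (Ass.T.bar_counit k finite_treeUnit c).symm)
    rw [map_prod, Nat.card_pi, Nat.cast_prod]
    refine Finset.prod_congr rfl fun i _ => ?_
    rw [card_treeUnit, ← Plin.gen_toList, Plin.counit_gen]
    split_ifs <;> simp
  exact DFunLike.congr_fun this a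

/-- The unital incidence bialgebra as a polynomial algebra. -/
noncomputable def equiv : Ass.T.Inc 0 ≃ₐ[ℚ] Plin :=
  AlgEquiv.ofLinearEquiv (LinearEquiv.ofBijective (toPlin 0) ⟨toPlin_injective, toPlin_surjective⟩)
    ((toPlin_δ_cls (k := 0) ⟨0, le_rfl, Fin.elim0⟩).trans (Fin.prod_univ_zero _))
    fun a b => by
      change toPlin 0 (a * b) = toPlin 0 a * toPlin 0 b
      rw [← toPlinHom_eq]
      exact map_mul (toPlinHom 0) a b

end Ass

/-- Transport of bialgebra structures along an isomorphism of algebras. -/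
theorem IsBialgebra.transport {A B : Type} [CommSemiring A] [Algebra ℚ A] [CommSemiring B]
    [Algebra ℚ B] (e : A ≃ₐ[ℚ] B) {Δ : A →ₗ[ℚ] A ⊗[ℚ] A} {ε : A →ₗ[ℚ] ℚ}
    {Δ' : B →ₗ[ℚ] B ⊗[ℚ] B} {ε' : B →ₗ[ℚ] ℚ} (h : IsBialgebra B Δ' ε')
    (hΔ : ∀ a, Algebra.TensorProduct.congr e e (Δ a) = Δ' (e a)) (hε : ∀ a, ε' (e a) = ε a) :
    IsBialgebra A Δ ε := by
  let e₂ := Algebra.TensorProduct.congr e e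
  -- This identity and the four after it say that e and its tensor powers carry the structure maps
  -- of A to those of B; each is checked on pure tensors. The axioms then follow by injectivity of e
  -- and its tensor powers.
  have hassoc : ∀ (x : A ⊗[ℚ] A) (b : A), Algebra.TensorProduct.congr e e₂
      (TensorProduct.assoc ℚ A A A (x ⊗ₜ b)) = TensorProduct.assoc ℚ B B B (e₂ x ⊗ₜ e b) := by
    intro x b
    induction x with
    | zero => simp
    | add x y hx hy => simp only [TensorProduct.add_tmul, map_add, hx, hy]
    | tmul a a' => rfl
  have hl : ∀ x : A ⊗[ℚ] A, Algebra.TensorProduct.congr e e₂ (TensorProduct.assoc ℚ A A A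
      (Δ.rTensor A x)) = TensorProduct.assoc ℚ B B B (Δ'.rTensor B (e₂ x)) := by
    intro x
    induction x with
    | zero => simp
    | add x y hx hy => simp only [map_add, hx, hy]
    | tmul a b =>
      rw [LinearMap.rTensor_tmul, hassoc, hΔ]
      rfl
  have hr : ∀ x : A ⊗[ℚ] A, Algebra.TensorProduct.congr e e₂ (Δ.lTensor A x) =
      Δ'.lTensor B (e₂ x) := by
    intro x
    induction x with
    | zero => simp
    | add x y hx hy => simp only [map_add, hx, hy]
    | tmul a b => exact congrArg (fun y => e a ⊗ₜ y) (hΔ b)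
  have hcl : ∀ x : A ⊗[ℚ] A, e (TensorProduct.lid ℚ A (ε.rTensor A x)) =
      TensorProduct.lid ℚ B (ε'.rTensor B (e₂ x)) := by
    intro x
    induction x with
    | zero => simp
    | add x y hx hy => simp only [map_add, hx, hy]
    | tmul a b => simp [e₂, hε]
  have hcr : ∀ x : A ⊗[ℚ] A, e (TensorProduct.rid ℚ A (ε.lTensor A x)) =
      TensorProduct.rid ℚ B (ε'.lTensor B (e₂ x)) := by
    intro x
    induction x with
    | zero => simp
    | add x y hx hy => simp only [map_add, hx, hy]
    | tmul a b => simp [e₂, hε]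
  constructor
  · refine LinearMap.ext fun a => (Algebra.TensorProduct.congr e e₂).injective ?_
    refine (hl (Δ a)).trans (Eq.trans ?_ (hr (Δ a)).symm)
    rw [hΔ]
    exact DFunLike.congr_fun h.coassoc (e a)
  · intro a
    exact e.injective (by rw [hcl, hΔ, h.counit_left])
  · intro a
    exact e.injective (by rw [hcr, hΔ, h.counit_right])
  · exact e₂.injective (by rw [hΔ, map_one e, h.comul_one, map_one e₂])
  · intro a b
    exact e₂.injective (by rw [hΔ, map_mul e, h.comul_mul, map_mul e₂, hΔ, hΔ])
  · rw [← hε, map_one, h.counit_one]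
  · intro a b
    rw [← hε, map_mul, h.counit_mul, hε, hε]

namespace Ass

theorem congr_equiv_comul (a : Ass.T.Inc 0) :
    Algebra.TensorProduct.congr equiv equiv ((Ass.T.bar 0).comul a) = Plin.comul (equiv a) :=
  map_toPlin_comul a

end Ass

end Pleth

/-! ### Assembly of the theorem -/

theorem mainTheorem10 :
    (Ass.T.bar 1).LocallyFinite ∧ (Ass.T.bar 0).LocallyFinite ∧
    ∃ Δ : Plin →ₐ[ℚ] Plin ⊗[ℚ] Plin,
      Plin.IsPlethysticComul Δ ∧
      (∀ Δ' : Plin →ₐ[ℚ] Plin ⊗[ℚ] Plin, Plin.IsPlethysticComul Δ' → Δ' = Δ) ∧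
      IsBialgebra Plin Δ.toLinearMap Plin.counit.toLinearMap ∧
      (∃ j : Ass.T.Inc 1 →ₙₐ[ℚ] Plin,
        Function.Injective j ∧
        (∀ p : Plin, p ∈ Set.range j ↔ MvPolynomial.constantCoeff p = 0) ∧
        (∀ a, TensorProduct.map (j : Ass.T.Inc 1 →ₗ[ℚ] Plin) (j : Ass.T.Inc 1 →ₗ[ℚ] Plin)
          ((Ass.T.bar 1).comul a) = Δ (j a)) ∧
        (∀ a, Plin.counit (j a) = (Ass.T.bar 1).counit a)) ∧
      IsBialgebra (Ass.T.Inc 0) (Ass.T.bar 0).comul (Ass.T.bar 0).counit ∧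
      (∃ e : Plin ≃ₐ[ℚ] Ass.T.Inc 0,
        (∀ p, TensorProduct.map e.toLinearMap e.toLinearMap (Δ p) = (Ass.T.bar 0).comul (e p)) ∧
        (∀ p, (Ass.T.bar 0).counit (e p) = Plin.counit p)) := by
  have lf : ∀ k, (Ass.T.bar k).LocallyFinite := fun k =>
    Ass.T.bar_locallyFinite k Ass.finite_treeComp Ass.finite_treeUnit
  have hj : ∀ a, Ass.toPlinHom 1 a = Ass.toPlin 1 a := fun a =>
    DFunLike.congr_fun Ass.toPlinHom_eq a
  refine ⟨lf 1, lf 0, Plin.comul, Plin.isPlethysticComul_comul,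
    fun Δ' h => Plin.isPlethysticComul_comul.unique h, Plin.isBialgebra,
    ⟨Ass.toPlinHom 1, ?_, fun p => ?_, fun a => ?_, fun a => ?_⟩,
    Plin.isBialgebra.transport Ass.equiv Ass.congr_equiv_comul Ass.counit_toPlin,
    ⟨Ass.equiv.symm, fun p => ?_, fun p => ?_⟩⟩
  · exact fun a b h => Ass.toPlin_injective ((hj a).symm.trans (h.trans (hj b)))
  · rw [← Ass.mem_range_toPlin]
    exact exists_congr fun a => by rw [hj a]
  · rw [Ass.toPlinHom_eq, hj]
    exact Ass.map_toPlin_comul a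
  · rw [hj]
    exact Ass.counit_toPlin a
  -- Applying the tensor square of `Ass.equiv` reduces compatibility of the inverse to that of
  -- `Ass.equiv` itself.
  · refine (Algebra.TensorProduct.congr Ass.equiv Ass.equiv).injective ?_
    rw [Ass.congr_equiv_comul, AlgEquiv.apply_symm_apply]
    exact (Algebra.TensorProduct.congr Ass.equiv Ass.equiv).apply_symm_apply (Plin.comul p)
  · refine (Ass.counit_toPlin _).symm.trans (congrArg Plin.counit ?_)
    exact Ass.equiv.apply_symm_apply p
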